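/- For every $n\ge 1$ let $0<f_1\le f_2\le\dots\le f_n$ be deterministic opening costs (which may depend on $n$) on the vertex set $V=\{1,\dots,n\}$ of the complete graph $K_n$, and assume that, for some constant $q$, $f_n/f_1\le n^q$ for all sufficiently large $n$. Give the edges of $K_n$ independent weights that are exponentially distributed with parameter $1$, and let $d(u,v)$ be the minimum total weight of a path from $u$ to $v$ in $K_n$. For nonempty $U\subseteq V$ let $$c(U)=\sum_{u\in U}f_u+\sum_{v\in V}\min_{u\in U}d(u,v),\qquad \mathsf{OPT}=\min_{\varnothing\ne U\subseteq V}c(U).$$ Let $\kappa=\kappa(n;f_1,\dots,f_n)=\max\{i\in\{1,\dots,n\}: f_i<1/(i-1)\}$, where $1/0=\infty$, and let $\mathsf{ALG}=c(U_n)$, where $U_n$ is a set of $\kappa$ cheapest facilities, chosen independently of the metric, with ties broken arbitrarily. If $\kappa=o(n)$ as $n\to\infty$, then $$\mathbb{E}\left[\frac{\mathsf{ALG}}{\mathsf{OPT}}\right]=1+o(1)\qquad(n\to\infty),$$ where $\mathsf{ALG}/\mathsf{OPT}$ is integrable for every $n$. -/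

import Mathlib

open MeasureTheory ProbabilityTheory Filter Topology Asymptotics

noncomputable section

namespace FacilityLocation

/-- The total weight of a walk in the complete graph. The weight function is written on all of
`Sym2 V`, but a walk uses only edges of the complete graph, so the values on the diagonal
(loops) are never used. -/
def walkWeight {V : Type*} (w : Sym2 V → ℝ) {u v : V} (p : (⊤ : SimpleGraph V).Walk u v) : ℝ :=
  (p.edges.map w).sum

/-- The shortest path distance: the minimum total weight of a path from `u` to `v` in the complete
graph. (For finite `V` there are finitely many paths, and at least one, so the infimum is a
minimum.) -/
def pathDist {V : Type*} (w : Sym2 V → ℝ) (u v : V) : ℝ :=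
  ⨅ p : (⊤ : SimpleGraph V).Path u v, walkWeight w (p : (⊤ : SimpleGraph V).Walk u v)

/-- The total cost `c(U) = f(U) + ∑_v min_{u ∈ U} d(u, v)` of opening the facilities in the
nonempty set `U`. -/
def cost {V : Type*} [Fintype V] (f : V → ℝ) (d : V → V → ℝ) (U : Finset V) : ℝ :=
  ∑ u ∈ U, f u + ∑ v, ⨅ u : U, d u v

/-- The optimal total cost: the minimum of `c(U)` over all nonempty sets `U` of vertices. -/
def opt {V : Type*} [Fintype V] (f : V → ℝ) (d : V → V → ℝ) : ℝ :=
  ⨅ U : {U : Finset V // U.Nonempty}, cost f d U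

open Classical in
/-- `κ = max {i ∈ [n] : f_i < 1/(i-1)}`, with `1/0 = ∞`. The index `i ∈ [n]` is the element
`i - 1` of `Fin n`. -/
def kappa {n : ℕ} (f : Fin n → ℝ) : ℕ :=
  (Finset.univ.filter fun i : Fin n => (i : ℕ) = 0 ∨ f i < 1 / (i : ℝ)).sup
    fun i : Fin n => (i : ℕ) + 1

/-- `U` consists of `k` cheapest facilities (ties may be broken in any way). -/
def IsCheapest {V : Type*} (f : V → ℝ) (k : ℕ) (U : Finset V) : Prop :=
  U.card = k ∧ ∀ u ∈ U, ∀ v, v ∉ U → f u ≤ f v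

end FacilityLocation

end

/-! Grow a ball around `U`, with `|U| = k`. The cheapest of the `k(n-k)` edges leaving `U` is
exponential with rate `k(n-k)`, and all `n-k` outside vertices wait for it, so this stage
contributes an exponential variable of rate `k` to the connection cost. Thus the cost behaves like a
sum of independent exponentials with rates `k, ..., n-1`: its mean is about `log (n/k)`, and its
Laplace transform is a product of factors `i/(i+s)`. Only upper bounds are needed.
`integral_connCost_le` and `integral_exp_neg_connCost_le` obtain them without constructing the
exploration: by memorylessness all edges of the cut are shifted by a small `θ`, the event that some
cut edge is below `θ` is charged to the set with one more vertex, and `θ` tends to `0`.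

The Laplace bound and a union bound over all small sets (`measureReal_exists_connCost_lt_le`) show
that, outside an event of polynomially small probability, every small `W` has connection cost at
least `(1-ε) log (n/|W|)`. The threshold defining `κ` makes `k ↦ f_1 + ... + f_k + log (n/k)`
minimal at `k = κ` up to an additive constant (`le_sum_add_of_log_le`). Hence `OPT` is at least
`(1-ε)(F + log (n/κ)) - O(1)`, where `F` is the opening cost of the heuristic, while the mean of
`ALG` is at most `F + 1 + log (n/κ)`. Since `κ = o(n)`, the logarithm tends to infinity and the
constants vanish in the ratio.

On the exceptional event `OPT` is at least the cheapest opening cost, which is polynomially bounded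
below, and a second moment bound controls `ALG` (`integral_cost_div_opt_le`). -/

namespace FacilityLocation

/-! ### Deterministic effect of changing edge weights on distances to a set. -/

section Distances

variable {V : Type*}

theorem walkWeight_nil (w : Sym2 V → ℝ) (u : V) :
    walkWeight w (SimpleGraph.Walk.nil : (⊤ : SimpleGraph V).Walk u u) = 0 := by
  simp [walkWeight]

theorem walkWeight_cons (w : Sym2 V → ℝ) {u v x : V} (h : (⊤ : SimpleGraph V).Adj u v)
    (p : (⊤ : SimpleGraph V).Walk v x) :
    walkWeight w (SimpleGraph.Walk.cons h p) = w s(u, v) + walkWeight w p := by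
  simp [walkWeight]

theorem walkWeight_nonneg {w : Sym2 V → ℝ} (hw : ∀ e, 0 ≤ w e) {u v : V}
    (p : (⊤ : SimpleGraph V).Walk u v) : 0 ≤ walkWeight w p :=
  List.sum_nonneg (by simpa using fun a _ => hw a)

instance nonempty_path (u v : V) : Nonempty ((⊤ : SimpleGraph V).Path u v) := by
  classical
  by_cases h : u = v
  · subst h
    exact ⟨SimpleGraph.Path.nil⟩
  · exact ⟨SimpleGraph.Path.singleton (by simpa using h)⟩

/-- A walk can be replaced by its part after the last visit to `U`, which uses at most one edge
that meets `U`. -/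
theorem exists_walkWeight_le_add {w w' : Sym2 V → ℝ} (hw : ∀ e, 0 ≤ w e) {U : Finset V} {θ : ℝ}
    (hθ : 0 ≤ θ) (hout : ∀ a b, a ∉ U → b ∉ U → w' s(a, b) ≤ w s(a, b))
    (hcut : ∀ a b, a ∈ U → b ∉ U → w' s(a, b) ≤ w s(a, b) + θ) {a v : V}
    (p : (⊤ : SimpleGraph V).Walk a v) :
    (∃ u ∈ U, ∃ q : (⊤ : SimpleGraph V).Walk u v, walkWeight w' q ≤ walkWeight w p + θ) ∨
      (a ∉ U ∧ walkWeight w' p ≤ walkWeight w p) := by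
  induction p with
  | @nil u =>
    by_cases hu : u ∈ U
    · exact .inl ⟨u, hu, .nil, by simpa [walkWeight_nil] using hθ⟩
    · exact .inr ⟨hu, by simp [walkWeight_nil]⟩
  | @cons a b v h p ih =>
    rw [walkWeight_cons, walkWeight_cons]
    rcases ih with ⟨u, hu, q, hq⟩ | ⟨hb, hp⟩
    · exact .inl ⟨u, hu, q, by linarith [hw s(a, b)]⟩
    · by_cases ha : a ∈ U
      · exact .inl ⟨a, ha, .cons h p, by rw [walkWeight_cons]; linarith [hcut a b ha hb]⟩
      · exact .inr ⟨ha, by linarith [hout a b ha hb]⟩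

/-- A walk from `U` to a vertex outside must cross the cut at least once, and pays `θ` there. -/
theorem walkWeight_add_le {w w' : Sym2 V → ℝ} {U : Finset V} {θ : ℝ} (hle : ∀ e, w e ≤ w' e)
    (hcut : ∀ a b, a ∈ U → b ∉ U → w s(a, b) + θ ≤ w' s(a, b)) {a v : V} (hv : v ∉ U)
    (p : (⊤ : SimpleGraph V).Walk a v) :
    walkWeight w p ≤ walkWeight w' p ∧ (a ∈ U → walkWeight w p + θ ≤ walkWeight w' p) := by
  induction p with
  | nil => exact ⟨by simp [walkWeight_nil], fun h => absurd h hv⟩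
  | @cons a b v h p ih =>
    rw [walkWeight_cons, walkWeight_cons]
    obtain ⟨h1, h2⟩ := ih hv
    refine ⟨add_le_add (hle _) h1, fun ha => ?_⟩
    by_cases hb : b ∈ U
    · linarith [h2 hb, hle s(a, b)]
    · linarith [hcut a b ha hb]

variable [Fintype V]

/-- The distance from the vertex `v` to the set `U`. -/
noncomputable def setDist (w : Sym2 V → ℝ) (U : Finset V) (v : V) : ℝ :=
  ⨅ u : U, pathDist w u v

/-- The connection cost of the set `U`. -/
noncomputable def connCost (w : Sym2 V → ℝ) (U : Finset V) : ℝ :=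
  ∑ v, setDist w U v

theorem cost_eq (f : V → ℝ) (w : Sym2 V → ℝ) (U : Finset V) :
    cost f (pathDist w) U = ∑ u ∈ U, f u + connCost w U := rfl

theorem pathDist_le_walkWeight {w : Sym2 V → ℝ} (hw : ∀ e, 0 ≤ w e) {u v : V}
    (p : (⊤ : SimpleGraph V).Walk u v) : pathDist w u v ≤ walkWeight w p := by
  classical
  refine (ciInf_le (Set.finite_range _).bddBelow p.toPath).trans ?_
  refine List.Sublist.sum_le_sum (p.edges_bypass_sublist_edges.map w) ?_
  simpa using fun a _ => hw a

theorem exists_walkWeight_eq_pathDist (w : Sym2 V → ℝ) (u v : V) :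
    ∃ p : (⊤ : SimpleGraph V).Walk u v, walkWeight w p = pathDist w u v := by
  classical
  obtain ⟨p, hp⟩ := exists_eq_ciInf_of_finite
    (f := fun p : (⊤ : SimpleGraph V).Path u v =>
      walkWeight w (p : (⊤ : SimpleGraph V).Walk u v))
  exact ⟨p, hp⟩

theorem setDist_le_walkWeight {w : Sym2 V → ℝ} (hw : ∀ e, 0 ≤ w e) {U : Finset V} {u v : V}
    (hu : u ∈ U) (p : (⊤ : SimpleGraph V).Walk u v) : setDist w U v ≤ walkWeight w p :=
  (ciInf_le (Set.finite_range _).bddBelow (⟨u, hu⟩ : U)).trans (pathDist_le_walkWeight hw p)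

theorem exists_walkWeight_eq_setDist (w : Sym2 V → ℝ) {U : Finset V} (hU : U.Nonempty) (v : V) :
    ∃ u ∈ U, ∃ p : (⊤ : SimpleGraph V).Walk u v, walkWeight w p = setDist w U v := by
  have : Nonempty U := hU.to_subtype
  obtain ⟨u, hu⟩ := exists_eq_ciInf_of_finite (f := fun u : U => pathDist w u v)
  obtain ⟨p, hp⟩ := exists_walkWeight_eq_pathDist w u v
  exact ⟨u, u.2, p, hp.trans hu⟩

theorem setDist_nonneg {w : Sym2 V → ℝ} (hw : ∀ e, 0 ≤ w e) {U : Finset V} (hU : U.Nonempty)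
    (v : V) : 0 ≤ setDist w U v := by
  obtain ⟨u, -, p, hp⟩ := exists_walkWeight_eq_setDist w hU v
  exact hp ▸ walkWeight_nonneg hw p

theorem setDist_of_mem {w : Sym2 V → ℝ} (hw : ∀ e, 0 ≤ w e) {U : Finset V} {v : V}
    (hv : v ∈ U) : setDist w U v = 0 :=
  le_antisymm ((setDist_le_walkWeight hw hv .nil).trans_eq (walkWeight_nil w v))
    (setDist_nonneg hw ⟨v, hv⟩ v)

theorem connCost_nonneg {w : Sym2 V → ℝ} (hw : ∀ e, 0 ≤ w e) {U : Finset V} (hU : U.Nonempty) :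
    0 ≤ connCost w U :=
  Finset.sum_nonneg fun v _ => setDist_nonneg hw hU v

theorem setDist_mono {w : Sym2 V → ℝ} (hw : ∀ e, 0 ≤ w e) {U W : Finset V} (hU : U.Nonempty)
    (h : U ⊆ W) (v : V) : setDist w W v ≤ setDist w U v := by
  obtain ⟨u, hu, p, hp⟩ := exists_walkWeight_eq_setDist w hU v
  exact hp ▸ setDist_le_walkWeight hw (h hu) p

theorem connCost_mono {w : Sym2 V → ℝ} (hw : ∀ e, 0 ≤ w e) {U W : Finset V} (hU : U.Nonempty)
    (h : U ⊆ W) : connCost w W ≤ connCost w U :=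
  Finset.sum_le_sum fun v _ => setDist_mono hw hU h v

/-- A shortest walk can be cut at its last visit to `U`, so it crosses the cut only once. Nothing is
assumed to relate the two weights on edges inside `U`, which is what makes `connCost_congr` a
special case. -/
theorem setDist_le_setDist_add {w w' : Sym2 V → ℝ} (hw : ∀ e, 0 ≤ w e) (hw' : ∀ e, 0 ≤ w' e)
    {U : Finset V} (hU : U.Nonempty) {θ : ℝ}
    (hθ : 0 ≤ θ) (hout : ∀ a b, a ∉ U → b ∉ U → w' s(a, b) ≤ w s(a, b))
    (hcut : ∀ a b, a ∈ U → b ∉ U → w' s(a, b) ≤ w s(a, b) + θ) (v : V) :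
    setDist w' U v ≤ setDist w U v + θ := by
  obtain ⟨u, hu, p, hp⟩ := exists_walkWeight_eq_setDist w hU v
  rcases exists_walkWeight_le_add hw hθ hout hcut p with ⟨u', hu', q, hq⟩ | ⟨h, -⟩
  · exact (setDist_le_walkWeight hw' hu' q).trans (hp ▸ hq)
  · exact absurd hu h

/-- The distances to `U` do not depend on the weights of the edges inside `U`. -/
theorem connCost_congr {w w' : Sym2 V → ℝ} (hw : ∀ e, 0 ≤ w e) (hw' : ∀ e, 0 ≤ w' e)
    {U : Finset V} (hU : U.Nonempty) (h : ∀ a b, b ∉ U → w' s(a, b) = w s(a, b)) :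
    connCost w' U = connCost w U := by
  refine Finset.sum_congr rfl fun v _ => le_antisymm ?_ ?_
  · simpa using setDist_le_setDist_add hw hw' hU le_rfl (fun a b _ hb => (h a b hb).le)
      (fun a b _ hb => by simp [h a b hb]) v
  · simpa using setDist_le_setDist_add hw' hw hU le_rfl (fun a b _ hb => (h a b hb).ge)
      (fun a b _ hb => by simp [h a b hb]) v

theorem setDist_add_le_setDist {w w' : Sym2 V → ℝ} (hw : ∀ e, 0 ≤ w e)
    {U : Finset V} (hU : U.Nonempty) {θ : ℝ} (hle : ∀ e, w e ≤ w' e)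
    (hcut : ∀ a b, a ∈ U → b ∉ U → w s(a, b) + θ ≤ w' s(a, b)) {v : V} (hv : v ∉ U) :
    setDist w U v + θ ≤ setDist w' U v := by
  obtain ⟨u, hu, p, hp⟩ := exists_walkWeight_eq_setDist w' hU v
  rw [← hp]
  linarith [(walkWeight_add_le hle hcut hv p).2 hu, setDist_le_walkWeight hw hu p]

theorem sum_add_compl [DecidableEq V] (g : V → ℝ) (U : Finset V) (θ : ℝ) :
    ∑ v, (g v + if v ∈ U then 0 else θ) =
      ∑ v, g v + ((Fintype.card V : ℝ) - U.card) * θ := by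
  rw [Finset.sum_add_distrib, Finset.sum_ite, Finset.sum_const_zero, Finset.sum_const, zero_add,
    nsmul_eq_mul]
  congr 2
  rw [Finset.filter_notMem_eq_sdiff, Finset.card_univ_sdiff, Nat.cast_sub (Finset.card_le_univ U)]

/-- Raising the weights of the edges between `U` and its complement by `θ` raises all distances
from `U` to other vertices by `θ`. -/
theorem connCost_of_cut_shift {w w' : Sym2 V → ℝ} (hw : ∀ e, 0 ≤ w e) (hw' : ∀ e, 0 ≤ w' e)
    {U : Finset V} (hU : U.Nonempty) {θ : ℝ} (hθ : 0 ≤ θ) (hle : ∀ e, w e ≤ w' e)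
    (hout : ∀ a b, a ∉ U → b ∉ U → w' s(a, b) = w s(a, b))
    (hcut : ∀ a b, a ∈ U → b ∉ U → w' s(a, b) = w s(a, b) + θ) :
    connCost w' U = connCost w U + ((Fintype.card V : ℝ) - U.card) * θ := by
  classical
  rw [connCost, connCost, ← sum_add_compl]
  refine Finset.sum_congr rfl fun v _ => ?_
  by_cases hv : v ∈ U
  · simp [hv, setDist_of_mem hw, setDist_of_mem hw']
  · rw [if_neg hv]
    exact le_antisymm (setDist_le_setDist_add hw hw' hU hθ (fun a b ha hb => (hout a b ha hb).le)
      (fun a b ha hb => (hcut a b ha hb).le) v)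
      (setDist_add_le_setDist hw hU hle (fun a b ha hb => (hcut a b ha hb).ge) hv)

/-- A walk starting at `v` can be prolonged by the edge from `u`, so no vertex loses more than that
edge's weight. -/
theorem connCost_le_connCost_insert_add [DecidableEq V] {w : Sym2 V → ℝ} (hw : ∀ e, 0 ≤ w e)
    {U : Finset V} {u v : V} (hu : u ∈ U) (hv : v ∉ U) :
    connCost w U ≤ connCost w (insert v U) + (Fintype.card V : ℝ) * w s(u, v) := by
  have key : ∀ x, setDist w U x ≤ setDist w (insert v U) x + w s(u, v) := by
    intro x
    obtain ⟨y, hy, p, hp⟩ := exists_walkWeight_eq_setDist w (Finset.insert_nonempty v U) x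
    rw [← hp]
    rcases Finset.mem_insert.1 hy with rfl | hy
    · have hadj : (⊤ : SimpleGraph V).Adj u y := by
        rw [SimpleGraph.top_adj]
        rintro rfl
        exact hv hu
      have := setDist_le_walkWeight hw hu (.cons hadj p)
      rw [walkWeight_cons] at this
      linarith
    · linarith [setDist_le_walkWeight hw hy p, hw s(u, v)]
  calc connCost w U ≤ ∑ x, (setDist w (insert v U) x + w s(u, v)) :=
        Finset.sum_le_sum fun x _ => key x
    _ = _ := by simp [connCost, Finset.sum_add_distrib]

theorem setDist_le_weight {w : Sym2 V → ℝ} (hw : ∀ e, 0 ≤ w e) {U : Finset V} {u v : V}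
    (hu : u ∈ U) : setDist w U v ≤ w s(u, v) := by
  by_cases h : u = v
  · subst h
    exact (setDist_of_mem hw hu).trans_le (hw _)
  · have hadj : (⊤ : SimpleGraph V).Adj u v := by simpa using h
    simpa [walkWeight_cons, walkWeight_nil] using
      setDist_le_walkWeight hw hu (.cons hadj .nil)

/-- The connection cost is at most the total weight of a star. -/
theorem connCost_le_sum {w : Sym2 V → ℝ} (hw : ∀ e, 0 ≤ w e) {U : Finset V} {u : V}
    (hu : u ∈ U) : connCost w U ≤ ∑ v, w s(u, v) :=
  Finset.sum_le_sum fun _ _ => setDist_le_weight hw hu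

theorem measurable_connCost (U : Finset V) :
    Measurable fun w : Sym2 V → ℝ => connCost w U := by
  classical
  unfold connCost setDist pathDist walkWeight
  refine Finset.measurable_sum _ fun v _ => Measurable.iInf fun u => Measurable.iInf fun p => ?_
  generalize SimpleGraph.Walk.edges _ = l
  induction l with
  | nil => simp
  | cons e l ih =>
    simp only [List.map_cons, List.sum_cons]
    exact (measurable_pi_apply e).add ih

end Distances

/-! ### Memorylessness for products of exponential distributions. -/

section ExponentialShift

open scoped ENNReal

instance isProbabilityMeasure_expMeasure_one : IsProbabilityMeasure (expMeasure 1) :=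
  isProbabilityMeasure_expMeasure one_pos

theorem expMeasure_one_eq : expMeasure 1 = volume.withDensity (exponentialPDF 1) := rfl

theorem measurable_exponentialPDF : Measurable (exponentialPDF 1) :=
  (measurable_exponentialPDFReal 1).ennreal_ofReal

theorem ae_expMeasure_nonneg : ∀ᵐ x ∂expMeasure 1, 0 ≤ x := by
  rw [expMeasure_one_eq, ae_withDensity_iff measurable_exponentialPDF]
  refine Eventually.of_forall fun x hx => ?_
  by_contra h
  exact hx (exponentialPDF_of_neg (not_le.1 h))

/-- The exponential distribution has no memory. -/
theorem map_add_expMeasure {θ : ℝ} (hθ : 0 ≤ θ) :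
    (expMeasure 1).map (fun x => x + θ) =
      ENNReal.ofReal (Real.exp θ) • (expMeasure 1).restrict (Set.Ici θ) := by
  ext s hs
  have hm : Measurable fun x : ℝ => x + θ := measurable_id.add_const θ
  rw [Measure.map_apply hm hs, Measure.smul_apply, Measure.restrict_apply hs, expMeasure_one_eq,
    withDensity_apply _ (hm hs), withDensity_apply _ (hs.inter measurableSet_Ici),
    ← lintegral_indicator (hm hs), ← lintegral_indicator (hs.inter measurableSet_Ici), smul_eq_mul,
    ← lintegral_const_mul _ (measurable_exponentialPDF.indicator (hs.inter measurableSet_Ici))]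
  refine Eq.trans ?_ (lintegral_add_right_eq_self _ θ)
  refine lintegral_congr fun x => ?_
  by_cases hx : x + θ ∈ s
  · rw [Set.indicator_of_mem (show x ∈ _ from hx)]
    by_cases h0 : 0 ≤ x
    · rw [Set.indicator_of_mem (show x + θ ∈ s ∩ Set.Ici θ from ⟨hx, by simpa using h0⟩), exponentialPDF_of_nonneg h0,
        exponentialPDF_of_nonneg (by positivity), ← ENNReal.ofReal_mul (Real.exp_pos _).le]
      congr 1
      rw [one_mul, one_mul, one_mul, one_mul, ← Real.exp_add]
      congr 1
      ring
    · rw [Set.indicator_of_notMem (by simpa using fun _ => not_le.1 h0),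
        exponentialPDF_of_neg (not_le.1 h0), mul_zero]
  · rw [Set.indicator_of_notMem (show x ∉ _ from hx), Set.indicator_of_notMem (fun h => hx h.1),
      mul_zero]

variable {ι : Type*}

theorem measurableSet_forall_le (C : Finset ι) (θ : ℝ) :
    MeasurableSet {x : ι → ℝ | ∀ i ∈ C, θ ≤ x i} := by
  have : {x : ι → ℝ | ∀ i ∈ C, θ ≤ x i} = ⋂ i ∈ C, {x | θ ≤ x i} := by ext; simp
  rw [this]
  exact Finset.measurableSet_biInter _ fun i _ =>
    measurableSet_le measurable_const (measurable_pi_apply i)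

variable [Fintype ι]

variable (ι) in
/-- The joint distribution of independent standard exponential variables. -/
noncomputable def expPi : Measure (ι → ℝ) := Measure.pi fun _ => expMeasure 1

instance : IsProbabilityMeasure (expPi ι) := by unfold expPi; infer_instance

theorem ae_expPi_nonneg : ∀ᵐ x ∂expPi ι, ∀ i, 0 ≤ x i := by
  rw [ae_all_iff]
  intro i
  exact (measurePreserving_eval (fun _ : ι => expMeasure 1) i).quasiMeasurePreserving.ae
    ae_expMeasure_nonneg

theorem map_add_expPi {t : ι → ℝ} (ht : ∀ i, 0 ≤ t i) :
    (expPi ι).map (fun x => x + t) =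
      ENNReal.ofReal (Real.exp (∑ i, t i)) • (expPi ι).restrict {x | ∀ i, t i ≤ x i} := by
  have hset : {x : ι → ℝ | ∀ i, t i ≤ x i} = Set.univ.pi fun i => Set.Ici (t i) := by
    ext x; simp only [Set.mem_ofPred_eq, Set.mem_univ_pi, Set.mem_Ici]
  have hm : ∀ i, AEMeasurable (fun x : ℝ => x + t i) (expMeasure 1) := fun i =>
    (measurable_id.add_const (t i)).aemeasurable
  have hprob : ∀ i, IsProbabilityMeasure ((expMeasure 1).map fun x => x + t i) := fun i =>
    Measure.isProbabilityMeasure_map (hm i)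
  have h1 : (expPi ι).map (fun x => x + t) =
      Measure.pi fun i => (expMeasure 1).map (fun x => x + t i) :=
    Measure.pi_map_pi (μ := fun _ : ι => expMeasure 1) (f := fun i x => x + t i) hm
  rw [h1, hset]
  refine Measure.pi_eq fun s hs => ?_
  rw [Measure.smul_apply, expPi, Measure.restrict_pi_pi, Measure.pi_pi, Real.exp_sum,
    ENNReal.ofReal_prod_of_nonneg fun i _ => (Real.exp_pos _).le, smul_eq_mul,
    ← Finset.prod_mul_distrib]
  refine Finset.prod_congr rfl fun i _ => ?_
  rw [map_add_expMeasure (ht i), Measure.smul_apply, smul_eq_mul]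

open Classical in
/-- The vector with entries `θ` on `C` and `0` elsewhere. -/
noncomputable def shiftVec (C : Finset ι) (θ : ℝ) : ι → ℝ := fun i => if i ∈ C then θ else 0

theorem setIntegral_expPi_eq {C : Finset ι} {θ : ℝ} (hθ : 0 ≤ θ) {G : (ι → ℝ) → ℝ}
    (hG : Measurable G) :
    ∫ x in {x | ∀ i ∈ C, θ ≤ x i}, G x ∂expPi ι =
      Real.exp (-(θ * C.card)) * ∫ x, G (x + shiftVec C θ) ∂expPi ι := by
  classical
  have ht : ∀ i, 0 ≤ shiftVec C θ i := fun i => by unfold shiftVec; split_ifs <;> simp [hθ]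
  have hsum : ∑ i, shiftVec C θ i = θ * C.card := by
    simp [shiftVec, mul_comm]
  have h := congrArg (fun ν => ∫ x, G x ∂ν) (map_add_expPi ht)
  rw [integral_map (by fun_prop) hG.aestronglyMeasurable, integral_smul_measure, hsum,
    ENNReal.toReal_ofReal (Real.exp_pos _).le, smul_eq_mul] at h
  rw [h, ← mul_assoc, ← Real.exp_add, neg_add_cancel, Real.exp_zero, one_mul]
  refine setIntegral_congr_set ?_
  -- Off `C` the shift is `0`, and the constraint `0 ≤ x i` holds almost surely, so the two events
  -- agree up to a null set.
  filter_upwards [ae_expPi_nonneg (ι := ι)] with x hx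
  refine propext ⟨fun h i => ?_, fun h i hi => ?_⟩
  · unfold shiftVec
    split_ifs with hi
    · exact h i hi
    · exact hx i
  · have := h i
    rwa [shiftVec, if_pos hi] at this

/-- A function of the other coordinates is independent of `x i`. -/
theorem setIntegral_lt_expPi {θ : ℝ} (hθ : 0 ≤ θ) {G : (ι → ℝ) → ℝ} (hG : Measurable G)
    (hint : Integrable G (expPi ι)) (i : ι)
    (hinv : ∀ x, (∀ j, 0 ≤ x j) → G (x + shiftVec {i} θ) = G x) :
    ∫ x in {x | x i < θ}, G x ∂expPi ι = (1 - Real.exp (-θ)) * ∫ x, G x ∂expPi ι := by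
  have h := setIntegral_expPi_eq (C := {i}) hθ hG
  have h2 := integral_add_compl (measurableSet_forall_le ({i} : Finset ι) θ) hint
  have h3 : {x : ι → ℝ | ∀ j ∈ ({i} : Finset ι), θ ≤ x j}ᶜ = {x | x i < θ} := by
    ext; simp
  have h4 : ∫ x, G (x + shiftVec {i} θ) ∂expPi ι = ∫ x, G x ∂expPi ι :=
    integral_congr_ae (ae_expPi_nonneg.mono hinv)
  rw [h3, h, h4] at h2
  simp only [Finset.card_singleton, Nat.cast_one, mul_one] at h2
  linarith

/-- Splitting according to whether some coordinate in `C` is less than `θ`. -/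
theorem integral_expPi_le {C : Finset ι} {θ : ℝ} (hθ : 0 ≤ θ) {G : (ι → ℝ) → ℝ}
    (hG : Measurable G) (hint : Integrable G (expPi ι))
    (hnn : ∀ᵐ x ∂expPi ι, 0 ≤ G x) :
    ∫ x, G x ∂expPi ι ≤ Real.exp (-(θ * C.card)) * ∫ x, G (x + shiftVec C θ) ∂expPi ι +
      ∑ i ∈ C, ∫ x in {x | x i < θ}, G x ∂expPi ι := by
  classical
  rw [← integral_add_compl (measurableSet_forall_le C θ) hint, setIntegral_expPi_eq hθ hG]
  gcongr
  have hms : ∀ i, MeasurableSet {x : ι → ℝ | x i < θ} := fun i =>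
    measurableSet_lt (measurable_pi_apply i) measurable_const
  rw [← integral_indicator (measurableSet_forall_le C θ).compl]
  simp_rw [← integral_indicator (hms _)]
  rw [← integral_finsetSum _ fun i _ => hint.indicator (hms i)]
  refine integral_mono_ae (hint.indicator (measurableSet_forall_le C θ).compl)
    (integrable_finsetSum _ fun i _ => hint.indicator (hms i)) ?_
  filter_upwards [hnn] with x hx
  have hnn' : ∀ i ∈ C, 0 ≤ Set.indicator {x : ι → ℝ | x i < θ} G x := fun i _ =>
    Set.indicator_apply_nonneg fun _ => hx
  by_cases h : ∀ i ∈ C, θ ≤ x i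
  · rw [Set.indicator_of_notMem (by simpa using h)]
    exact Finset.sum_nonneg hnn'
  · push Not at h
    obtain ⟨i, hi, hlt⟩ := h
    rw [Set.indicator_of_mem (by simpa using ⟨i, hi, hlt⟩)]
    refine le_trans ?_ (Finset.single_le_sum hnn' hi)
    rw [Set.indicator_of_mem (show x ∈ _ from hlt)]

theorem integrable_sq_expMeasure : Integrable (fun x => x ^ 2) (expMeasure 1) := by
  rw [expMeasure_one_eq, integrable_withDensity_iff measurable_exponentialPDF
    (by simp [exponentialPDF])]
  -- The second moment is the integral for `Γ(3)`.
  have h := Real.GammaIntegral_convergent (s := 3) (by norm_num)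
  rw [← integrable_indicator_iff measurableSet_Ioi] at h
  refine h.congr ?_
  have : ∀ᵐ x : ℝ, x ≠ 0 := by simp [ae_iff]
  filter_upwards [this] with x hx
  rcases lt_or_gt_of_ne hx with h0 | h0
  · rw [exponentialPDF_of_neg h0, Set.indicator_of_notMem (by simpa using h0.le)]
    simp
  · rw [exponentialPDF_of_nonneg h0.le, Set.indicator_of_mem (by simpa using h0),
      ENNReal.toReal_ofReal (by positivity), mul_comm]
    norm_num

theorem memLp_two_eval (i : ι) : MemLp (fun x : ι → ℝ => x i) 2 (expPi ι) := by
  rw [memLp_two_iff_integrable_sq (measurable_pi_apply i).aestronglyMeasurable]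
  exact (measurePreserving_eval (fun _ : ι => expMeasure 1) i).integrable_comp_of_integrable
    integrable_sq_expMeasure

theorem integral_eval_sq (i : ι) :
    ∫ x : ι → ℝ, x i ^ 2 ∂expPi ι = ∫ x, x ^ 2 ∂expMeasure 1 := by
  rw [← (measurePreserving_eval (fun _ : ι => expMeasure 1) i).map_eq,
    integral_map (measurable_pi_apply i).aemeasurable (by fun_prop)]
  rfl

end ExponentialShift

/-- This replaces differentiation at `θ = 0`: since `exp (-y) * (1 + y) ≤ 1`, the factor `1 - exp
(-θc)` may be traded for `θc / (1 + θc)`, and dividing by `θ` leaves a limit. The term `θ * r`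
allows a second-order error. -/
theorem mul_le_of_mul_one_sub_exp_le {A b c r : ℝ} (hA : 0 ≤ A) (hc : 0 ≤ c)
    (h : ∀ θ : ℝ, 0 < θ → A * (1 - Real.exp (-(θ * c))) ≤ θ * (b + θ * r)) : A * c ≤ b := by
  have hlim : Tendsto (fun θ : ℝ => (b + θ * r) * (1 + θ * c)) (𝓝[>] 0)
      (𝓝 ((b + 0 * r) * (1 + 0 * c))) :=
    (Continuous.tendsto (by fun_prop) 0).mono_left nhdsWithin_le_nhds
  simp only [zero_mul, add_zero, mul_one] at hlim
  refine ge_of_tendsto hlim ?_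
  filter_upwards [self_mem_nhdsWithin] with θ hθ
  have hθ : 0 < θ := hθ
  have hy : 0 < 1 + θ * c := by positivity
  have hexp : Real.exp (-(θ * c)) * (1 + θ * c) ≤ 1 := by
    rw [Real.exp_neg, inv_mul_le_iff₀ (Real.exp_pos _), mul_one, add_comm]
    exact Real.add_one_le_exp _
  have h1 : A * (θ * c) ≤ A * (1 - Real.exp (-(θ * c))) * (1 + θ * c) := by
    rw [mul_assoc]
    exact mul_le_mul_of_nonneg_left (by linarith) hA
  have h2 := mul_le_mul_of_nonneg_right (h θ hθ) hy.le
  refine le_of_mul_le_mul_left ?_ hθ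
  linarith

/-! ### Laplace transform and mean of the connection cost. -/

section RandomWeights

variable {V : Type*}

open Classical in
/-- Extends weights on the edges of the complete graph by zero on loops. -/
noncomputable def extendWeight (x : (⊤ : SimpleGraph V).edgeSet → ℝ) (e : Sym2 V) : ℝ :=
  if h : e ∈ (⊤ : SimpleGraph V).edgeSet then x ⟨e, h⟩ else 0

theorem extendWeight_nonneg {x : (⊤ : SimpleGraph V).edgeSet → ℝ} (hx : ∀ e, 0 ≤ x e)
    (e : Sym2 V) : 0 ≤ extendWeight x e := by
  unfold extendWeight
  split_ifs
  · exact hx _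
  · exact le_rfl

theorem extendWeight_of_ne (x : (⊤ : SimpleGraph V).edgeSet → ℝ) {a b : V} (h : a ≠ b) :
    extendWeight x s(a, b) = x ⟨s(a, b), by simpa using h⟩ := by
  unfold extendWeight
  rw [dif_pos (by simpa using h)]

theorem extendWeight_self (x : (⊤ : SimpleGraph V).edgeSet → ℝ) (a : V) :
    extendWeight x s(a, a) = 0 := by
  unfold extendWeight
  rw [dif_neg (by simp)]

theorem measurable_extendWeight :
    Measurable (extendWeight : ((⊤ : SimpleGraph V).edgeSet → ℝ) → Sym2 V → ℝ) := by
  refine measurable_pi_lambda _ fun e => ?_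
  unfold extendWeight
  split_ifs with h
  · exact measurable_pi_apply _
  · exact measurable_const

theorem walkWeight_extendWeight (w : Sym2 V → ℝ) {u v : V} (p : (⊤ : SimpleGraph V).Walk u v) :
    walkWeight (extendWeight fun e => w e) p = walkWeight w p := by
  unfold walkWeight
  congr 1
  refine List.map_congr_left fun e he => ?_
  rw [extendWeight, dif_pos (p.edges_subset_edgeSet he)]

/-- Walks use no loops; this lets the whole analysis take place on the product space over genuine
edges. -/
theorem pathDist_extendWeight (w : Sym2 V → ℝ) :
    pathDist (extendWeight fun e => w e) = pathDist w := by
  ext u v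
  simp only [pathDist, walkWeight_extendWeight]

theorem extendWeight_add_shiftVec_nonneg {x : (⊤ : SimpleGraph V).edgeSet → ℝ}
    (hx : ∀ e, 0 ≤ x e) (C : Finset (⊤ : SimpleGraph V).edgeSet) {θ : ℝ} (hθ : 0 ≤ θ)
    (e : Sym2 V) : extendWeight x e ≤ extendWeight (x + shiftVec C θ) e ∧
      0 ≤ extendWeight (x + shiftVec C θ) e := by
  have h : extendWeight x e ≤ extendWeight (x + shiftVec C θ) e := by
    unfold extendWeight
    split_ifs with h
    · simp only [Pi.add_apply, shiftVec]
      split_ifs <;> linarith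
    · exact le_rfl
  exact ⟨h, (extendWeight_nonneg hx e).trans h⟩

theorem extendWeight_add_shiftVec_of_notMem (x : (⊤ : SimpleGraph V).edgeSet → ℝ)
    (C : Finset (⊤ : SimpleGraph V).edgeSet) (θ : ℝ) {e : Sym2 V} (he : ∀ i ∈ C, (i : Sym2 V) ≠ e) :
    extendWeight (x + shiftVec C θ) e = extendWeight x e := by
  unfold extendWeight
  split_ifs with h
  · have : (⟨e, h⟩ : (⊤ : SimpleGraph V).edgeSet) ∉ C := fun hC => he _ hC rfl
    simp [shiftVec, this]
  · rfl

variable [Fintype V]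

theorem measurable_connCost_extendWeight (U : Finset V) :
    Measurable fun x : (⊤ : SimpleGraph V).edgeSet → ℝ => connCost (extendWeight x) U :=
  (measurable_connCost U).comp measurable_extendWeight

variable [DecidableEq V]

/-- The edges with exactly one end in `U`. -/
noncomputable def cutEdges (U : Finset V) : Finset (⊤ : SimpleGraph V).edgeSet :=
  Finset.univ.filter fun e => ∃ a ∈ U, ∃ b, b ∉ U ∧ (e : Sym2 V) = s(a, b)

theorem card_cutEdges (U : Finset V) :
    ((cutEdges U).card : ℝ) = U.card * ((Fintype.card V : ℝ) - U.card) := by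
  have hne : ∀ p : V × V, p ∈ U ×ˢ Uᶜ → p.1 ≠ p.2 := by
    rintro ⟨a, b⟩ h (rfl : a = b)
    simp at h
  have h : (U ×ˢ Uᶜ).card = (cutEdges U).card := by
    refine Finset.card_bij (fun p hp => ⟨s(p.1, p.2), by simpa using hne p hp⟩) ?_ ?_ ?_
    · rintro ⟨a, b⟩ h
      simp only [Finset.mem_product, Finset.mem_compl] at h
      exact Finset.mem_filter.2 ⟨Finset.mem_univ _, a, h.1, b, h.2, rfl⟩
    · rintro ⟨a, b⟩ h ⟨c, d⟩ h' he
      simp only [Finset.mem_product, Finset.mem_compl] at h h'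
      simp only [Subtype.mk.injEq, Sym2.eq_iff] at he
      rcases he with ⟨rfl, rfl⟩ | ⟨rfl, rfl⟩
      · rfl
      · exact absurd h.1 h'.2
    · intro e he
      obtain ⟨-, a, ha, b, hb, heq⟩ := Finset.mem_filter.1 he
      exact ⟨(a, b), by simp [ha, hb], Subtype.ext heq.symm⟩
  rw [← h, Finset.card_product, Finset.card_compl, Nat.cast_mul,
    Nat.cast_sub (Finset.card_le_univ U)]

theorem connCost_add_shiftVec_cutEdges {U : Finset V} (hU : U.Nonempty) {θ : ℝ} (hθ : 0 ≤ θ)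
    {x : (⊤ : SimpleGraph V).edgeSet → ℝ} (hx : ∀ e, 0 ≤ x e) :
    connCost (extendWeight (x + shiftVec (cutEdges U) θ)) U =
      connCost (extendWeight x) U + ((Fintype.card V : ℝ) - U.card) * θ := by
  refine connCost_of_cut_shift (extendWeight_nonneg hx)
    (fun e => (extendWeight_add_shiftVec_nonneg hx _ hθ e).2) hU hθ
    (fun e => (extendWeight_add_shiftVec_nonneg hx _ hθ e).1) ?_ ?_
  · intro a b ha hb
    refine extendWeight_add_shiftVec_of_notMem x _ θ fun i hi => ?_
    obtain ⟨-, c, hc, d, hd, heq⟩ := Finset.mem_filter.1 hi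
    rw [heq]
    intro h
    rcases Sym2.eq_iff.1 h with ⟨rfl, rfl⟩ | ⟨rfl, rfl⟩
    · exact ha hc
    · exact hb hc
  · intro a b ha hb
    have hab : a ≠ b := fun h => hb (h ▸ ha)
    have : (⟨s(a, b), by simpa using hab⟩ : (⊤ : SimpleGraph V).edgeSet) ∈ cutEdges U :=
      Finset.mem_filter.2 ⟨Finset.mem_univ _, a, ha, b, hb, rfl⟩
    rw [extendWeight_of_ne _ hab, extendWeight_of_ne _ hab, Pi.add_apply, shiftVec, if_pos this]

/-- Once `v` has joined the set, the edge `uv` is internal and irrelevant. Hence the connection cost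
of the larger set is independent of that edge's weight. -/
theorem connCost_insert_add_shiftVec_singleton {U : Finset V} {u v : V} (hu : u ∈ U)
    {i : (⊤ : SimpleGraph V).edgeSet} (hi : (i : Sym2 V) = s(u, v)) {θ : ℝ} (hθ : 0 ≤ θ)
    {x : (⊤ : SimpleGraph V).edgeSet → ℝ} (hx : ∀ e, 0 ≤ x e) :
    connCost (extendWeight (x + shiftVec {i} θ)) (insert v U) =
      connCost (extendWeight x) (insert v U) := by
  refine connCost_congr (extendWeight_nonneg hx)
    (fun e => (extendWeight_add_shiftVec_nonneg hx _ hθ e).2) (Finset.insert_nonempty v U) ?_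
  intro a b hb
  refine extendWeight_add_shiftVec_of_notMem x _ θ fun j hj => ?_
  rw [Finset.mem_singleton.1 hj, hi]
  intro h
  rcases Sym2.eq_iff.1 h with ⟨rfl, rfl⟩ | ⟨rfl, rfl⟩
  · exact hb (Finset.mem_insert_self _ _)
  · exact hb (Finset.mem_insert_of_mem hu)

theorem memLp_connCost {U : Finset V} (hU : U.Nonempty) :
    MemLp (fun x => connCost (extendWeight x) U) 2 (expPi (⊤ : SimpleGraph V).edgeSet) := by
  obtain ⟨u, hu⟩ := hU
  have hsum : MemLp (fun x => ∑ v, extendWeight x s(u, v)) 2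
      (expPi (⊤ : SimpleGraph V).edgeSet) := by
    refine memLp_finsetSum _ fun v _ => ?_
    by_cases h : u = v
    · subst h
      simp [extendWeight_self]
    · simp only [extendWeight_of_ne _ h]
      exact memLp_two_eval _
  refine hsum.mono (measurable_connCost_extendWeight U).aestronglyMeasurable ?_
  filter_upwards [ae_expPi_nonneg (ι := (⊤ : SimpleGraph V).edgeSet)] with x hx
  have h0 := connCost_nonneg (extendWeight_nonneg hx) ⟨u, hu⟩
  have h1 := connCost_le_sum (extendWeight_nonneg hx) hu
  rw [Real.norm_of_nonneg h0, Real.norm_of_nonneg (h0.trans h1)]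
  exact h1

theorem integrable_connCost {U : Finset V} (hU : U.Nonempty) :
    Integrable (fun x => connCost (extendWeight x) U) (expPi (⊤ : SimpleGraph V).edgeSet) :=
  (memLp_connCost hU).integrable one_le_two

theorem ae_connCost_nonneg {U : Finset V} (hU : U.Nonempty) :
    ∀ᵐ x ∂expPi (⊤ : SimpleGraph V).edgeSet, 0 ≤ connCost (extendWeight x) U :=
  ae_expPi_nonneg.mono fun _ hx => connCost_nonneg (extendWeight_nonneg hx) hU

theorem integrable_exp_neg_connCost {U : Finset V} (hU : U.Nonempty) {s : ℝ} (hs : 0 ≤ s) :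
    Integrable (fun x => Real.exp (-(s * connCost (extendWeight x) U)))
      (expPi (⊤ : SimpleGraph V).edgeSet) := by
  refine Integrable.of_bound (C := 1)
    (((measurable_connCost_extendWeight U).const_mul s).neg.exp.aestronglyMeasurable) ?_
  filter_upwards [ae_connCost_nonneg hU] with x hx
  rw [Real.norm_of_nonneg (Real.exp_pos _).le, Real.exp_le_one_iff]
  simpa using mul_nonneg hs hx

/-- The Laplace transform of the connection cost of `U`. -/
theorem integral_exp_neg_connCost_le {s : ℝ} (hs : 0 ≤ s) {U : Finset V} (hU : U.Nonempty) :
    ∫ x, Real.exp (-(s * connCost (extendWeight x) U)) ∂expPi (⊤ : SimpleGraph V).edgeSet ≤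
      ∏ i ∈ Finset.Ico U.card (Fintype.card V), ((i : ℝ) / (i + s)) := by
  induction hm : Fintype.card V - U.card generalizing U with
  | zero =>
    rw [Finset.Ico_eq_empty_of_le (by lia), Finset.prod_empty]
    calc _ ≤ ∫ _, (1 : ℝ) ∂expPi (⊤ : SimpleGraph V).edgeSet := by
          refine integral_mono_ae (integrable_exp_neg_connCost hU hs) (integrable_const _) ?_
          filter_upwards [ae_connCost_nonneg hU] with x hx
          rw [Real.exp_le_one_iff]
          simpa using mul_nonneg hs hx
      _ = 1 := by simp
  | succ m ih =>
    set n := Fintype.card V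
    set k := U.card
    set B : ℝ := ∏ i ∈ Finset.Ico (k + 1) n, ((i : ℝ) / (i + s))
    set A : ℝ := ∫ x, Real.exp (-(s * connCost (extendWeight x) U))
      ∂expPi (⊤ : SimpleGraph V).edgeSet
    have hkn : k < n := by lia
    have hk : 0 < k := hU.card_pos
    have hk' : (0 : ℝ) < k := by exact_mod_cast hk
    have hnk : (0 : ℝ) < (n : ℝ) - k := sub_pos.2 (by exact_mod_cast hkn)
    have hA : 0 ≤ A := integral_nonneg fun x => (Real.exp_pos _).le
    have hmeas : ∀ W : Finset V, Measurable fun x : (⊤ : SimpleGraph V).edgeSet → ℝ =>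
        Real.exp (-(s * connCost (extendWeight x) W)) := fun W =>
      ((measurable_connCost_extendWeight W).const_mul s).neg.exp
    -- Either all `k(n-k)` cut edges exceed `θ`, and memorylessness reproduces `A` with an
    -- exponential factor, or one of them is short, which costs at most `θ * B` per edge. No
    -- second-order error arises here.
    have key : A * (((n : ℝ) - k) * (k + s)) ≤ k * ((n : ℝ) - k) * B := by
      refine mul_le_of_mul_one_sub_exp_le (r := 0) hA (by positivity) fun θ hθ => ?_
      have h1 := integral_expPi_le (C := cutEdges U) hθ.le (hmeas U)
        (integrable_exp_neg_connCost hU hs) (Eventually.of_forall fun x => (Real.exp_pos _).le)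
      have h2 : ∫ x, Real.exp (-(s * connCost (extendWeight (x + shiftVec (cutEdges U) θ)) U))
          ∂expPi (⊤ : SimpleGraph V).edgeSet = Real.exp (-(s * (((n : ℝ) - k) * θ))) * A := by
        rw [← integral_const_mul]
        refine integral_congr_ae ?_
        filter_upwards [ae_expPi_nonneg (ι := (⊤ : SimpleGraph V).edgeSet)] with x hx
        rw [connCost_add_shiftVec_cutEdges hU hθ.le hx, ← Real.exp_add]
        congr 1
        ring
      -- Enlarging the set only lowers the connection cost, so the exponential increases; the new
      -- integrand is independent of `x i`.
      have h3 : ∀ i ∈ cutEdges U, ∫ x in {x | x i < θ},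
          Real.exp (-(s * connCost (extendWeight x) U)) ∂expPi (⊤ : SimpleGraph V).edgeSet ≤
            θ * B := by
        intro i hi
        obtain ⟨-, u, hu, v, hv, heq⟩ := Finset.mem_filter.1 hi
        have hne := Finset.insert_nonempty v U
        have hcard : (insert v U).card = k + 1 := Finset.card_insert_of_notMem hv
        have hB := ih hne (by lia)
        rw [hcard] at hB
        calc _ ≤ ∫ x in {x | x i < θ}, Real.exp (-(s * connCost (extendWeight x) (insert v U)))
              ∂expPi (⊤ : SimpleGraph V).edgeSet := by
              refine setIntegral_mono_ae (integrable_exp_neg_connCost hU hs).integrableOn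
                (integrable_exp_neg_connCost hne hs).integrableOn ?_
              filter_upwards [ae_expPi_nonneg (ι := (⊤ : SimpleGraph V).edgeSet)] with x hx
              have := connCost_mono (extendWeight_nonneg hx) hU (Finset.subset_insert v U)
              gcongr
          _ = (1 - Real.exp (-θ)) * ∫ x, Real.exp (-(s * connCost (extendWeight x) (insert v U)))
              ∂expPi (⊤ : SimpleGraph V).edgeSet := by
              refine setIntegral_lt_expPi hθ.le (hmeas _) (integrable_exp_neg_connCost hne hs) i ?_
              intro x hx
              rw [connCost_insert_add_shiftVec_singleton hu heq hθ.le hx]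
          _ ≤ θ * B := by
              have := Real.add_one_le_exp (-θ)
              exact mul_le_mul (by linarith) hB (integral_nonneg fun x => (Real.exp_pos _).le) hθ.le
      have h4 := Finset.sum_le_sum h3
      rw [Finset.sum_const, nsmul_eq_mul] at h4
      rw [h2, ← mul_assoc, ← Real.exp_add] at h1
      rw [card_cutEdges] at h1 h4
      have h5 : -(θ * ((k : ℝ) * ((n : ℝ) - k))) + -(s * (((n : ℝ) - k) * θ)) =
        -(θ * (((n : ℝ) - k) * (k + s))) := by ring
      rw [h5] at h1
      change A ≤ _ at h1
      linarith
    rw [Finset.prod_eq_prod_Ico_succ_bot hkn]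
    change A ≤ k / (k + s) * B
    rw [div_mul_eq_mul_div, le_div_iff₀ (by positivity)]
    refine le_of_mul_le_mul_left ?_ hnk
    linarith

/-- The mean of the connection cost of `U`. -/
theorem integral_connCost_le {U : Finset V} (hU : U.Nonempty) :
    ∫ x, connCost (extendWeight x) U ∂expPi (⊤ : SimpleGraph V).edgeSet ≤
      ∑ i ∈ Finset.Ico U.card (Fintype.card V), (1 : ℝ) / i := by
  induction hm : Fintype.card V - U.card generalizing U with
  | zero =>
    rw [Finset.Ico_eq_empty_of_le (by lia), Finset.sum_empty]
    have hU' : U = Finset.univ := by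
      rw [← Finset.card_eq_iff_eq_univ]
      exact le_antisymm (Finset.card_le_univ U) (by lia)
    refine (integral_eq_zero_of_ae ?_).le
    filter_upwards [ae_expPi_nonneg (ι := (⊤ : SimpleGraph V).edgeSet)] with x hx
    refine Finset.sum_eq_zero fun v _ => setDist_of_mem (extendWeight_nonneg hx) ?_
    rw [hU']
    exact Finset.mem_univ v
  | succ m ih =>
    set n := Fintype.card V
    set k := U.card
    set B : ℝ := ∑ i ∈ Finset.Ico (k + 1) n, (1 : ℝ) / i
    set A : ℝ := ∫ x, connCost (extendWeight x) U ∂expPi (⊤ : SimpleGraph V).edgeSet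
    have hkn : k < n := by lia
    have hk : 0 < k := hU.card_pos
    have hk' : (0 : ℝ) < k := by exact_mod_cast hk
    have hnk : (0 : ℝ) < (n : ℝ) - k := sub_pos.2 (by exact_mod_cast hkn)
    have hA : 0 ≤ A := integral_nonneg_of_ae (ae_connCost_nonneg hU)
    -- Same splitting as for the Laplace transform, but monotonicity now points the wrong way.
    -- Adding `v` across an edge shorter than `θ` changes the cost by at most `n * θ`, and this
    -- occurs with probability at most `θ` for each cut edge, which explains `r`.
    have key : A * (k * ((n : ℝ) - k)) ≤ ((n : ℝ) - k) + k * ((n : ℝ) - k) * B := by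
      refine mul_le_of_mul_one_sub_exp_le (r := k * ((n : ℝ) - k) * n) hA (by positivity)
        fun θ hθ => ?_
      have h1 := integral_expPi_le (C := cutEdges U) hθ.le (measurable_connCost_extendWeight U)
        (integrable_connCost hU) (ae_connCost_nonneg hU)
      have h2 : ∫ x, connCost (extendWeight (x + shiftVec (cutEdges U) θ)) U
          ∂expPi (⊤ : SimpleGraph V).edgeSet = A + ((n : ℝ) - k) * θ := by
        calc _ = ∫ x, (connCost (extendWeight x) U + ((n : ℝ) - k) * θ)
              ∂expPi (⊤ : SimpleGraph V).edgeSet := by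
              refine integral_congr_ae ?_
              filter_upwards [ae_expPi_nonneg (ι := (⊤ : SimpleGraph V).edgeSet)] with x hx
              exact connCost_add_shiftVec_cutEdges hU hθ.le hx
          _ = _ := by
              rw [integral_add (integrable_connCost hU) (integrable_const _)]
              simp [A]
      have h3 : ∀ i ∈ cutEdges U, ∫ x in {x | x i < θ},
          connCost (extendWeight x) U ∂expPi (⊤ : SimpleGraph V).edgeSet ≤
            θ * (B + n * θ) := by
        intro i hi
        obtain ⟨-, u, hu, v, hv, heq⟩ := Finset.mem_filter.1 hi
        have huv : u ≠ v := fun h => hv (h ▸ hu)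
        have hne := Finset.insert_nonempty v U
        have hcard : (insert v U).card = k + 1 := Finset.card_insert_of_notMem hv
        have hB := ih hne (by lia)
        rw [hcard] at hB
        have hint : Integrable (fun x => connCost (extendWeight x) (insert v U) + n * θ)
            (expPi (⊤ : SimpleGraph V).edgeSet) :=
          (integrable_connCost hne).add (integrable_const _)
        have hmean : ∫ x, (connCost (extendWeight x) (insert v U) + n * θ)
            ∂expPi (⊤ : SimpleGraph V).edgeSet ≤ B + n * θ := by
          rw [integral_add (integrable_connCost hne) (integrable_const _)]
          refine add_le_add hB ?_
          simp
        calc _ ≤ ∫ x in {x | x i < θ}, (connCost (extendWeight x) (insert v U) + n * θ)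
              ∂expPi (⊤ : SimpleGraph V).edgeSet := by
              refine setIntegral_mono_on_ae (integrable_connCost hU).integrableOn
                hint.integrableOn
                (measurableSet_lt (measurable_pi_apply i) measurable_const) ?_
              filter_upwards [ae_expPi_nonneg (ι := (⊤ : SimpleGraph V).edgeSet)] with x hx hlt
              refine (connCost_le_connCost_insert_add (extendWeight_nonneg hx) hu hv).trans ?_
              have hi' : i = ⟨s(u, v), by simpa using huv⟩ := Subtype.ext heq
              have hlt : x i < θ := hlt
              rw [extendWeight_of_ne _ huv, ← hi']
              gcongr
          _ = (1 - Real.exp (-θ)) * ∫ x, (connCost (extendWeight x) (insert v U) + n * θ)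
              ∂expPi (⊤ : SimpleGraph V).edgeSet := by
              refine setIntegral_lt_expPi hθ.le
                ((measurable_connCost_extendWeight _).add_const _) hint i ?_
              intro x hx
              rw [connCost_insert_add_shiftVec_singleton hu heq hθ.le hx]
          _ ≤ θ * (B + n * θ) := by
              have := Real.add_one_le_exp (-θ)
              refine mul_le_mul (by linarith) hmean (integral_nonneg_of_ae ?_) hθ.le
              filter_upwards [ae_connCost_nonneg hne] with x hx
              exact add_nonneg hx (by positivity)
      have h4 := Finset.sum_le_sum h3
      rw [Finset.sum_const, nsmul_eq_mul] at h4
      rw [h2, mul_add] at h1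
      rw [card_cutEdges] at h1 h4
      have h5 : Real.exp (-(θ * (k * ((n : ℝ) - k)))) * (((n : ℝ) - k) * θ) ≤
          1 * (((n : ℝ) - k) * θ) := by
        gcongr
        rw [Real.exp_le_one_iff, neg_nonpos]
        positivity
      change A ≤ _ at h1
      linarith
    rw [Finset.sum_eq_sum_Ico_succ_bot hkn]
    change A ≤ 1 / k + B
    refine le_of_mul_le_mul_left ?_ (mul_pos hk' hnk)
    have : (k : ℝ) * ((n : ℝ) - k) * (1 / k + B) =
        ((n : ℝ) - k) + k * ((n : ℝ) - k) * B := by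
      field_simp
    linarith

end RandomWeights

/-! ### Elementary bounds for products and binomial coefficients. -/

/-- For a natural number `s` the product telescopes to a quotient of two rising factorials of length
`s`. -/
theorem prod_Ico_div_add_mul_prod {k n : ℕ} (hk : 0 < k) (hkn : k ≤ n) (s : ℕ) :
    (∏ i ∈ Finset.Ico k n, ((i : ℝ) / (i + s))) * ∏ j ∈ Finset.range s, ((n : ℝ) + j) =
      ∏ j ∈ Finset.range s, ((k : ℝ) + j) := by
  induction n, hkn using Nat.le_induction with
  | base => simp
  | succ n hkn ih =>
    have hn : (0 : ℝ) < n := by exact_mod_cast hk.trans_le hkn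
    have h : (n : ℝ) * ∏ j ∈ Finset.range s, (((n + 1 : ℕ) : ℝ) + j) =
        (∏ j ∈ Finset.range s, ((n : ℝ) + j)) * (n + s) := by
      rw [← Finset.prod_range_succ, Finset.prod_range_succ', mul_comm]
      congr 1
      · refine Finset.prod_congr rfl fun j _ => ?_
        push_cast
        ring
      · simp
    rw [← ih, Finset.prod_Ico_succ_top hkn, mul_assoc, div_mul_eq_mul_div, h, mul_div_assoc,
      div_self (by positivity), mul_one]

theorem prod_Ico_div_add_le {k n : ℕ} (hk : 0 < k) (hkn : k ≤ n) (s : ℕ) :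
    ∏ i ∈ Finset.Ico k n, ((i : ℝ) / (i + s)) ≤ (((k : ℝ) + s) / n) ^ s := by
  have hn : (0 : ℝ) < n := by exact_mod_cast hk.trans_le hkn
  rw [div_pow, le_div_iff₀ (by positivity)]
  calc _ ≤ (∏ i ∈ Finset.Ico k n, ((i : ℝ) / (i + s))) * ∏ j ∈ Finset.range s, ((n : ℝ) + j) := by
        refine mul_le_mul_of_nonneg_left ?_ (Finset.prod_nonneg fun i _ => by positivity)
        calc (n : ℝ) ^ s = ∏ j ∈ Finset.range s, (n : ℝ) := by simp
          _ ≤ _ := Finset.prod_le_prod (fun _ _ => hn.le) fun j _ => by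
            linarith [Nat.cast_nonneg (α := ℝ) j]
    _ = ∏ j ∈ Finset.range s, ((k : ℝ) + j) := prod_Ico_div_add_mul_prod hk hkn s
    _ ≤ ∏ j ∈ Finset.range s, ((k : ℝ) + s) := by
        refine Finset.prod_le_prod (fun _ _ => by positivity) fun j hj => ?_
        have : (j : ℝ) ≤ s := by exact_mod_cast (Finset.mem_range.1 hj).le
        linarith
    _ = _ := by simp

theorem choose_le_pow_exp {n k : ℕ} (hk : 0 < k) :
    (n.choose k : ℝ) ≤ (Real.exp 1 * (n / k)) ^ k := by
  have hk' : (0 : ℝ) < k := by exact_mod_cast hk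
  refine (Nat.choose_le_pow_div k n).trans ?_
  have h := Real.pow_div_factorial_le_exp (k : ℝ) hk'.le k
  rw [div_le_iff₀ (by positivity)] at h
  rw [mul_pow, ← Real.exp_nat_mul, mul_one, div_pow, ← mul_div_assoc,
    div_le_div_iff₀ (by positivity) (by positivity)]
  calc (n : ℝ) ^ k * (k : ℝ) ^ k ≤ (n : ℝ) ^ k * (Real.exp k * k.factorial) := by gcongr
    _ = _ := by ring

/-- From `k ≤ 2 ^ (k-1)` one gets `k ^ k ≤ (2k) ^ (k-1) ≤ n ^ (k-1)`. The bound is uniform in `k`,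
as the union over set sizes requires. -/
theorem div_pow_self_le_inv {n k : ℕ} (hk : 0 < k) (h : 2 * k ≤ n) :
    ((k : ℝ) / n) ^ k ≤ 1 / n := by
  have hn : (0 : ℝ) < n := by exact_mod_cast (by lia : 0 < n)
  obtain ⟨m, rfl⟩ : ∃ m, k = m + 1 := ⟨k - 1, by lia⟩
  have h1 : (m + 1) ^ (m + 1) * n ≤ n ^ (m + 1) := by
    calc (m + 1) ^ (m + 1) * n = ((m + 1) * (m + 1) ^ m) * n := by ring
      _ ≤ (2 ^ m * (m + 1) ^ m) * n := by
          gcongr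
          exact Nat.lt_two_pow_self
      _ = (2 * (m + 1)) ^ m * n := by rw [mul_pow]
      _ ≤ n ^ m * n := by gcongr
      _ = _ := by ring
  rw [div_pow, div_le_div_iff₀ (by positivity) hn, one_mul]
  exact_mod_cast h1

/-! ### Lower tail of the connection cost, uniformly over small sets. -/

section LowerTail

variable {V : Type*} [Fintype V] [DecidableEq V]

/-- Chernoff bound with parameter `s = M * k`. The factor `exp (s * t)` cancels all but `r` of the
`M` powers of `k/n` (per element of `U`) in the Laplace bound; the price is the constant `(M + 1) ^
M`. -/
theorem measureReal_connCost_lt_le {U : Finset V} (hU : U.Nonempty) {M r : ℕ} (hM : 0 < M)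
    (hr : r ≤ M) :
    (expPi (⊤ : SimpleGraph V).edgeSet).real {x | connCost (extendWeight x) U <
      (1 - (r : ℝ) / M) * Real.log (Fintype.card V / U.card)} ≤
      (((M : ℝ) + 1) ^ M * ((U.card : ℝ) / Fintype.card V) ^ r) ^ U.card := by
  set n := Fintype.card V
  set k := U.card
  have hk : 0 < k := hU.card_pos
  have hkn : k ≤ n := Finset.card_le_univ U
  have hk' : (0 : ℝ) < k := by exact_mod_cast hk
  have hn' : (0 : ℝ) < n := by exact_mod_cast hk.trans_le hkn
  have hM' : (0 : ℝ) < M := by exact_mod_cast hM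
  set t := (1 - (r : ℝ) / M) * Real.log ((n : ℝ) / k)
  set s : ℕ := M * k
  have hs : (0 : ℝ) ≤ s := Nat.cast_nonneg s
  have hmarkov := mul_meas_ge_le_integral_of_nonneg
    (Eventually.of_forall fun x => (Real.exp_pos (-((s : ℝ) * connCost (extendWeight x) U))).le)
    (integrable_exp_neg_connCost hU hs) (Real.exp (-(s * t)))
  have hsub : {x | connCost (extendWeight x) U < t} ⊆
      {x : (⊤ : SimpleGraph V).edgeSet → ℝ | Real.exp (-(s * t)) ≤
        Real.exp (-((s : ℝ) * connCost (extendWeight x) U))} := by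
    intro x hx
    have hx : connCost (extendWeight x) U < t := hx
    change Real.exp _ ≤ Real.exp _
    gcongr
  have h1 : (expPi (⊤ : SimpleGraph V).edgeSet).real {x | connCost (extendWeight x) U < t} ≤
      Real.exp (s * t) * (((k : ℝ) + s) / n) ^ s := by
    have h2 := (mul_le_mul_of_nonneg_left (measureReal_mono hsub (by finiteness))
      (Real.exp_pos _).le).trans
      (hmarkov.trans ((integral_exp_neg_connCost_le hs hU).trans (prod_Ico_div_add_le hk hkn s)))
    rwa [Real.exp_neg, inv_mul_le_iff₀ (Real.exp_pos _)] at h2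
  refine h1.trans (le_of_eq ?_)
  have hst : (s : ℝ) * t = ((M - r) * k : ℕ) * Real.log ((n : ℝ) / k) := by
    simp only [s, t]
    rw [Nat.cast_mul, Nat.cast_mul, Nat.cast_sub hr]
    field_simp
  have hsk : ((k : ℝ) + s) / n = ((M : ℝ) + 1) * (k / n) := by
    simp only [s]
    push_cast
    ring
  rw [hst, hsk, Real.exp_nat_mul, Real.exp_log (by positivity)]
  obtain ⟨d, rfl⟩ := Nat.exists_eq_add_of_le hr
  have hinv : (n : ℝ) / k * (k / n) = 1 := by field_simp
  simp only [s]
  rw [Nat.add_sub_cancel_left, pow_mul, pow_mul, ← mul_pow]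
  congr 1
  rw [mul_pow, pow_add ((k : ℝ) / n) r d]
  calc _ = (((r + d : ℕ) : ℝ) + 1) ^ (r + d) * ((k : ℝ) / n) ^ r *
        ((n : ℝ) / k * (k / n)) ^ d := by ring
    _ = _ := by rw [hinv, one_pow, mul_one]

/-- With high probability, all small sets have a large connection cost. -/
theorem measureReal_exists_connCost_lt_le (R M : ℕ) (hM : R + 3 ≤ M) {δ : ℝ} (hδ : δ ≤ 1 / 2)
    (hδM : Real.exp 1 * ((M : ℝ) + 1) ^ M * δ ≤ 1) [Nonempty V] :
    (expPi (⊤ : SimpleGraph V).edgeSet).real {x | ∃ U : Finset V, U.Nonempty ∧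
      (U.card : ℝ) ≤ δ * Fintype.card V ∧ connCost (extendWeight x) U <
      (1 - ((R + 3 : ℕ) : ℝ) / M) * Real.log (Fintype.card V / U.card)} ≤
      (1 / (Fintype.card V : ℝ)) ^ R := by
  classical
  set n := Fintype.card V
  have hn : 0 < n := Fintype.card_pos
  have hn' : (0 : ℝ) < n := by exact_mod_cast hn
  set K : Finset ℕ := (Finset.Icc 1 n).filter fun k => (k : ℝ) ≤ δ * n
  let bad : Finset V → Set ((⊤ : SimpleGraph V).edgeSet → ℝ) := fun U =>
    {x | connCost (extendWeight x) U <
      (1 - ((R + 3 : ℕ) : ℝ) / M) * Real.log (Fintype.card V / U.card)}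
  have hsub : {x | ∃ U : Finset V, U.Nonempty ∧
      (U.card : ℝ) ≤ δ * Fintype.card V ∧ connCost (extendWeight x) U <
      (1 - ((R + 3 : ℕ) : ℝ) / M) * Real.log (Fintype.card V / U.card)} ⊆
      ⋃ k ∈ K, ⋃ U ∈ Finset.powersetCard k Finset.univ, bad U := by
    rintro x ⟨U, hU, hUδ, hx⟩
    simp only [Set.mem_iUnion]
    exact ⟨U.card, Finset.mem_filter.2 ⟨Finset.mem_Icc.2 ⟨hU.card_pos, Finset.card_le_univ U⟩, hUδ⟩,
      U, Finset.mem_powersetCard.2 ⟨Finset.subset_univ U, rfl⟩, hx⟩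
  refine (measureReal_mono hsub (measure_ne_top _ _)).trans ((measureReal_biUnion_finset_le _ _).trans ?_)
  -- Of the `R + 3` powers of `k/n`, one cancels the number of sets of size `k`, one absorbs the
  -- constant `e (M + 1) ^ M` by the choice of `δ`, and `R + 1` remain. The final sum over `k` uses
  -- up one more factor `1/n`.
  have hterm : ∀ k ∈ K, (expPi (⊤ : SimpleGraph V).edgeSet).real
      (⋃ U ∈ Finset.powersetCard k Finset.univ, bad U) ≤ (1 / (n : ℝ)) ^ (R + 1) := by
    intro k hk
    obtain ⟨hk1, hkδ⟩ := Finset.mem_filter.1 hk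
    have hk0 : 0 < k := (Finset.mem_Icc.1 hk1).1
    have hk' : (0 : ℝ) < k := by exact_mod_cast hk0
    have hy : (0 : ℝ) < (k : ℝ) / n := by positivity
    have hyδ : (k : ℝ) / n ≤ δ := by rwa [div_le_iff₀ hn']
    have hD : Real.exp 1 * ((M : ℝ) + 1) ^ M * ((k : ℝ) / n) ≤ 1 :=
      (mul_le_mul_of_nonneg_left hyδ (by positivity)).trans hδM
    have h2k : 2 * k ≤ n := by
      have : (2 : ℝ) * k ≤ n := by
        have := mul_le_mul_of_nonneg_right hδ hn'.le
        linarith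
      exact_mod_cast this
    calc _ ≤ ∑ U ∈ Finset.powersetCard k (Finset.univ : Finset V),
          (expPi (⊤ : SimpleGraph V).edgeSet).real (bad U) := measureReal_biUnion_finset_le _ _
      _ ≤ ∑ U ∈ Finset.powersetCard k (Finset.univ : Finset V),
          (((M : ℝ) + 1) ^ M * ((k : ℝ) / n) ^ (R + 3)) ^ k := by
          refine Finset.sum_le_sum fun U hU => ?_
          obtain ⟨-, rfl⟩ := Finset.mem_powersetCard.1 hU
          exact measureReal_connCost_lt_le (Finset.card_pos.1 hk0) (by lia) hM
      _ = (n.choose k : ℝ) * (((M : ℝ) + 1) ^ M * ((k : ℝ) / n) ^ (R + 3)) ^ k := by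
          rw [Finset.sum_const, Finset.card_powersetCard, Finset.card_univ, nsmul_eq_mul]
      _ ≤ (Real.exp 1 * (n / k)) ^ k * (((M : ℝ) + 1) ^ M * ((k : ℝ) / n) ^ (R + 3)) ^ k := by
          gcongr
          exact choose_le_pow_exp hk0
      _ = ((Real.exp 1 * ((M : ℝ) + 1) ^ M * ((k : ℝ) / n)) * ((k : ℝ) / n) ^ (R + 1)) ^ k := by
          rw [← mul_pow]
          congr 1
          have hinv : (n : ℝ) / k * (k / n) = 1 := by field_simp
          calc _ = Real.exp 1 * ((M : ℝ) + 1) ^ M * ((k : ℝ) / n) * ((k : ℝ) / n) ^ (R + 1) *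
                ((n : ℝ) / k * (k / n)) := by ring
            _ = _ := by rw [hinv, mul_one]
      _ ≤ (1 * ((k : ℝ) / n) ^ (R + 1)) ^ k := by gcongr
      _ = (((k : ℝ) / n) ^ k) ^ (R + 1) := by rw [one_mul, ← pow_mul, ← pow_mul, mul_comm]
      _ ≤ (1 / (n : ℝ)) ^ (R + 1) := by
          gcongr
          exact div_pow_self_le_inv hk0 h2k
  calc _ ≤ ∑ k ∈ K, (1 / (n : ℝ)) ^ (R + 1) := Finset.sum_le_sum hterm
    _ = (K.card : ℝ) * (1 / (n : ℝ)) ^ (R + 1) := by rw [Finset.sum_const, nsmul_eq_mul]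
    _ ≤ (n : ℝ) * (1 / (n : ℝ)) ^ (R + 1) := by
        gcongr
        exact (Finset.card_filter_le _ _).trans (by simp)
    _ = (1 / (n : ℝ)) ^ R := by
        rw [pow_succ, mul_comm, mul_assoc, one_div_mul_cancel hn'.ne', mul_one]

end LowerTail

/-! ### Harmonic sums and cheapest sets. -/

theorem log_div_le_sum_Ico {a b : ℕ} (ha : 0 < a) (hab : a ≤ b) :
    Real.log ((b : ℝ) / a) ≤ ∑ i ∈ Finset.Ico a b, (1 : ℝ) / i := by
  have ha' : (0 : ℝ) < a := by exact_mod_cast ha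
  induction b, hab using Nat.le_induction with
  | base => simp [ha'.ne']
  | succ b hab ih =>
    have hb : (0 : ℝ) < b := by exact_mod_cast ha.trans_le hab
    rw [Finset.sum_Ico_succ_top hab]
    have h := Real.log_le_sub_one_of_pos (x := ((b + 1 : ℕ) : ℝ) / b) (by positivity)
    have h2 : ((b + 1 : ℕ) : ℝ) / b - 1 = 1 / b := by
      push_cast
      field_simp
      ring
    have h3 : Real.log (((b + 1 : ℕ) : ℝ) / a) =
        Real.log ((b : ℝ) / a) + Real.log (((b + 1 : ℕ) : ℝ) / b) := by
      rw [← Real.log_mul (by positivity) (by positivity)]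
      congr 1
      field_simp
    linarith

theorem sum_Ico_le_one_add_log {a b : ℕ} (ha : 0 < a) (hab : a ≤ b) :
    ∑ i ∈ Finset.Ico a b, (1 : ℝ) / i ≤ 1 + Real.log ((b : ℝ) / a) := by
  have ha' : (0 : ℝ) < a := by exact_mod_cast ha
  have key : ∑ i ∈ Finset.Ico a b, (1 : ℝ) / i ≤ 1 / a - 1 / b + Real.log ((b : ℝ) / a) := by
    induction b, hab using Nat.le_induction with
    | base => simp [ha'.ne']
    | succ b hab ih =>
      have hb : (0 : ℝ) < b := by exact_mod_cast ha.trans_le hab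
      rw [Finset.sum_Ico_succ_top hab]
      have h := Real.one_sub_inv_le_log_of_pos (x := ((b + 1 : ℕ) : ℝ) / b) (by positivity)
      have h2 : 1 - (((b + 1 : ℕ) : ℝ) / b)⁻¹ = 1 / ((b + 1 : ℕ) : ℝ) := by
        push_cast
        field_simp
        ring
      have h3 : Real.log (((b + 1 : ℕ) : ℝ) / a) =
          Real.log ((b : ℝ) / a) + Real.log (((b + 1 : ℕ) : ℝ) / b) := by
        rw [← Real.log_mul (by positivity) (by positivity)]
        congr 1
        field_simp
      linarith
  have h1 : (1 : ℝ) / a ≤ 1 := by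
    rw [div_le_one ha']
    exact_mod_cast ha
  have h2 : (0 : ℝ) ≤ 1 / b := by positivity
  linarith

/-- Exchange argument: `U \ W` and `W \ U` have equal size, and the cheapest element of `W \ U`
separates their costs. -/
theorem IsCheapest.sum_le {V : Type*} {f : V → ℝ} {k : ℕ} {U : Finset V} (hU : IsCheapest f k U)
    {W : Finset V} (hW : W.card = k) : ∑ u ∈ U, f u ≤ ∑ u ∈ W, f u := by
  classical
  have hcard : (U \ W).card = (W \ U).card :=
    Finset.card_sdiff_comm (hU.1.trans hW.symm)
  have hUW := Finset.sum_inter_add_sum_sdiff U W f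
  have hWU := Finset.sum_inter_add_sum_sdiff W U f
  rw [Finset.inter_comm] at hWU
  suffices h : ∑ u ∈ U \ W, f u ≤ ∑ u ∈ W \ U, f u by linarith
  rcases (W \ U).eq_empty_or_nonempty with he | hne
  · rw [he, Finset.card_empty, Finset.card_eq_zero] at hcard
    rw [hcard, he]
  · obtain ⟨c, hc, hmin⟩ := Finset.exists_min_image (W \ U) f hne
    calc ∑ u ∈ U \ W, f u ≤ (U \ W).card • f c :=
          Finset.sum_le_card_nsmul _ _ _ fun u hu =>
            hU.2 u (Finset.mem_sdiff.1 hu).1 c (Finset.mem_sdiff.1 hc).2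
      _ = (W \ U).card • f c := by rw [hcard]
      _ ≤ _ := Finset.card_nsmul_le_sum _ _ _ hmin

/-! ### The threshold `κ` as approximate minimiser of opening cost plus logarithm. -/

section Kappa

variable {n : ℕ} {f : Fin n → ℝ}

theorem kappa_le : kappa f ≤ n :=
  Finset.sup_le fun i _ => i.2

theorem kappa_pos (hn : 0 < n) : 0 < kappa f := by
  classical
  have : (0 : ℕ) + 1 ≤ kappa f := by
    unfold kappa
    exact Finset.le_sup (f := fun i : Fin n => (i : ℕ) + 1) (b := ⟨0, hn⟩) (by simp)
  exact this

theorem lt_of_lt_kappa (hf : Monotone f) (i : Fin n) (hi : 0 < (i : ℕ)) (h : (i : ℕ) < kappa f) :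
    f i < 1 / (i : ℝ) := by
  unfold kappa at h
  obtain ⟨j, hj, hij⟩ := Finset.lt_sup_iff.1 h
  have hle : (i : ℕ) ≤ j := by lia
  have hj0 : (j : ℕ) ≠ 0 := by lia
  have hfj := (Finset.mem_filter.1 hj).2.resolve_left hj0
  have hi' : (0 : ℝ) < ((i : ℕ) : ℝ) := by exact_mod_cast hi
  calc f i ≤ f j := hf hle
    _ < 1 / ((j : ℕ) : ℝ) := hfj
    _ ≤ _ := one_div_le_one_div_of_le hi' (by exact_mod_cast hle)

theorem le_of_kappa_le (i : Fin n) (h : kappa f ≤ i) : 1 / (i : ℝ) ≤ f i := by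
  by_contra hlt
  push Not at hlt
  have : (i : ℕ) + 1 ≤ kappa f := by
    unfold kappa
    exact Finset.le_sup (f := fun i : Fin n => (i : ℕ) + 1) (by
      rw [Finset.mem_filter]
      exact ⟨Finset.mem_univ _, .inr hlt⟩)
  lia

/-- The sum of the first `k` opening costs. -/
noncomputable def prefixSum (f : Fin n → ℝ) (k : ℕ) : ℝ :=
  ∑ i ∈ Finset.range k, if h : i < n then f ⟨i, h⟩ else 0

theorem prefixSum_sub (f : Fin n → ℝ) {a b : ℕ} (hab : a ≤ b) :
    prefixSum f b - prefixSum f a =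
      ∑ i ∈ Finset.Ico a b, if h : i < n then f ⟨i, h⟩ else 0 :=
  (Finset.sum_Ico_eq_sub _ hab).symm

theorem exists_initialSegment (hf : Monotone f) {k : ℕ} (hk : k ≤ n) :
    ∃ I : Finset (Fin n), IsCheapest f k I ∧ ∑ i ∈ I, f i = prefixSum f k := by
  refine ⟨Finset.univ.map (Fin.castLEEmb hk), ⟨by simp, ?_⟩, ?_⟩
  · intro u hu v hv
    obtain ⟨i, -, rfl⟩ := Finset.mem_map.1 hu
    refine hf ?_
    by_contra h
    push Not at h
    refine hv (Finset.mem_map.2 ⟨⟨v, (Fin.lt_def.1 h).trans i.2⟩, Finset.mem_univ _, rfl⟩)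
  · rw [Finset.sum_map, prefixSum, Finset.sum_range]
    refine Finset.sum_congr rfl fun i _ => ?_
    rw [dif_pos (i.2.trans_le hk)]
    rfl

theorem prefixSum_card_le (hf : Monotone f) (W : Finset (Fin n)) :
    prefixSum f W.card ≤ ∑ i ∈ W, f i := by
  obtain ⟨I, hI, hsum⟩ := exists_initialSegment hf (k := W.card)
    ((Finset.card_le_univ W).trans_eq (Fintype.card_fin n))
  exact hsum ▸ hI.sum_le rfl

theorem IsCheapest.sum_le_prefixSum (hf : Monotone f) {U : Finset (Fin n)} {k : ℕ}
    (hU : IsCheapest f k U) (hk : k ≤ n) : ∑ i ∈ U, f i ≤ prefixSum f k := by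
  obtain ⟨I, hI, hsum⟩ := exists_initialSegment hf hk
  exact hsum ▸ hU.sum_le hI.1

theorem prefixSum_kappa_sub_le (hf : Monotone f) {k : ℕ} (hk : 0 < k) (hkκ : k ≤ kappa f) :
    prefixSum f (kappa f) - prefixSum f k ≤ 1 + Real.log ((kappa f : ℝ) / k) := by
  rw [prefixSum_sub f hkκ]
  refine le_trans (Finset.sum_le_sum fun i hi => ?_) (sum_Ico_le_one_add_log hk hkκ)
  obtain ⟨h1, h2⟩ := Finset.mem_Ico.1 hi
  rw [dif_pos (h2.trans_le kappa_le)]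
  exact (lt_of_lt_kappa hf _ (hk.trans_le h1) h2).le

theorem log_le_prefixSum_sub {k : ℕ} (hkn : k ≤ n) (hκk : kappa f ≤ k) (hκ : 0 < kappa f) :
    Real.log ((k : ℝ) / kappa f) ≤ prefixSum f k - prefixSum f (kappa f) := by
  rw [prefixSum_sub f hκk]
  refine (log_div_le_sum_Ico hκ hκk).trans (Finset.sum_le_sum fun i hi => ?_)
  obtain ⟨h1, h2⟩ := Finset.mem_Ico.1 hi
  rw [dif_pos (h2.trans_le hkn)]
  exact le_of_kappa_le ⟨i, _⟩ h1

/-- A lower bound for the cost of `W` in terms of the opening cost of the heuristic solution. -/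
theorem le_sum_add_of_log_le (hf : Monotone f) (hpos : ∀ i, 0 < f i) {U W : Finset (Fin n)}
    (hU : IsCheapest f (kappa f) U) (hW : W.Nonempty) {ε C T : ℝ} (hε0 : 0 ≤ ε) (hε1 : ε ≤ 1)
    (hT : (1 - ε) * Real.log ((n : ℝ) / W.card) - C ≤ T) :
    (1 - ε) * (∑ u ∈ U, f u + Real.log ((n : ℝ) / kappa f)) - (C + 1) ≤ ∑ u ∈ W, f u + T := by
  have hkn : W.card ≤ n := (Finset.card_le_univ W).trans_eq (Fintype.card_fin n)
  have hk : 0 < W.card := hW.card_pos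
  have hn : 0 < n := hk.trans_le hkn
  have hκ : 0 < kappa f := kappa_pos hn
  have hk' : (0 : ℝ) < W.card := by exact_mod_cast hk
  have hn' : (0 : ℝ) < n := by exact_mod_cast hn
  have hκ' : (0 : ℝ) < kappa f := by exact_mod_cast hκ
  have h1 := prefixSum_card_le hf W
  have h2 := hU.sum_le_prefixSum hf kappa_le
  have h2' := mul_le_mul_of_nonneg_left h2 (sub_nonneg.2 hε1)
  have hpre : ∀ k, 0 ≤ prefixSum f k := fun k => Finset.sum_nonneg fun i _ => by
    split_ifs
    · exact (hpos _).le
    · exact le_rfl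
  have hlogW : Real.log ((n : ℝ) / W.card) = Real.log n - Real.log W.card :=
    Real.log_div hn'.ne' hk'.ne'
  have hlogκ : Real.log ((n : ℝ) / kappa f) = Real.log n - Real.log (kappa f) :=
    Real.log_div hn'.ne' hκ'.ne'
  rw [hlogW] at hT
  rw [hlogκ]
  -- Below `κ` the missing facilities cost at most about `log (κ/|W|)`, which the larger connection
  -- cost of `W` compensates; above `κ` the extra facilities cost at least `log (|W|/κ)`, which
  -- covers the saving.
  rcases le_total W.card (kappa f) with h | h
  · have h3 := prefixSum_kappa_sub_le hf hk h
    rw [Real.log_div hκ'.ne' hk'.ne'] at h3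
    have h4 := mul_le_mul_of_nonneg_left h3 (sub_nonneg.2 hε1)
    have h5 := mul_nonneg hε0 (hpre W.card)
    linarith
  · have h3 := log_le_prefixSum_sub hkn h hκ
    have h0 : 0 ≤ Real.log ((W.card : ℝ) / kappa f) := by
      refine Real.log_nonneg ?_
      rw [one_le_div hκ']
      exact_mod_cast h
    rw [Real.log_div hk'.ne' hκ'.ne'] at h3 h0
    have h4 := mul_nonneg hε0 h0
    have h5 := mul_nonneg hε0 (hpre (kappa f))
    linarith

end Kappa

/-! ### Elementary bounds for the optimum. -/

section Opt

variable {V : Type*} [Fintype V]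

theorem opt_le_cost (f : V → ℝ) (d : V → V → ℝ) {U : Finset V} (hU : U.Nonempty) :
    opt f d ≤ cost f d U := by
  classical
  exact ciInf_le (Set.finite_range _).bddBelow (⟨U, hU⟩ : {U : Finset V // U.Nonempty})

theorem le_opt [Nonempty V] {f : V → ℝ} {d : V → V → ℝ} {c : ℝ}
    (h : ∀ U : Finset V, U.Nonempty → c ≤ cost f d U) : c ≤ opt f d := by
  have : Nonempty {U : Finset V // U.Nonempty} := ⟨⟨Finset.univ, Finset.univ_nonempty⟩⟩
  exact le_ciInf fun U => h U U.2

theorem le_opt_pathDist [Nonempty V] {f : V → ℝ} (hf : ∀ v, 0 ≤ f v) {c : ℝ} (hc : ∀ v, c ≤ f v)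
    {w : Sym2 V → ℝ} (hw : ∀ e, 0 ≤ w e) : c ≤ opt f (pathDist w) := by
  refine le_opt fun U hU => ?_
  obtain ⟨u, hu⟩ := hU
  rw [cost_eq]
  linarith [hc u, Finset.single_le_sum (f := f) (fun v _ => hf v) hu, connCost_nonneg hw ⟨u, hu⟩]

end Opt

/-! ### Integrability of the ratio and the effect of an exceptional event. -/

section Ratio

variable {V : Type*} [Fintype V]

theorem measurable_cost (f : V → ℝ) (U : Finset V) :
    Measurable fun x : (⊤ : SimpleGraph V).edgeSet → ℝ =>
      cost f (pathDist (extendWeight x)) U := by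
  simp only [cost_eq]
  exact (measurable_connCost_extendWeight U).const_add _

theorem measurable_opt (f : V → ℝ) :
    Measurable fun x : (⊤ : SimpleGraph V).edgeSet → ℝ => opt f (pathDist (extendWeight x)) := by
  classical
  exact Measurable.iInf fun U => measurable_cost f U

theorem measurable_cost_div_opt (f : V → ℝ) (U : Finset V) :
    Measurable fun x : (⊤ : SimpleGraph V).edgeSet → ℝ =>
      cost f (pathDist (extendWeight x)) U / opt f (pathDist (extendWeight x)) :=
  (measurable_cost f U).div (measurable_opt f)

variable [DecidableEq V]

theorem integrable_cost (f : V → ℝ) {U : Finset V} (hU : U.Nonempty) :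
    Integrable (fun x => cost f (pathDist (extendWeight x)) U)
      (expPi (⊤ : SimpleGraph V).edgeSet) := by
  simp only [cost_eq]
  exact (integrable_const _).add (integrable_connCost hU)

theorem integrable_cost_div_opt {f : V → ℝ} {c : ℝ} (hc : 0 < c) (hf : ∀ v, c ≤ f v)
    {U : Finset V} (hU : U.Nonempty) :
    Integrable (fun x => cost f (pathDist (extendWeight x)) U / opt f (pathDist (extendWeight x)))
      (expPi (⊤ : SimpleGraph V).edgeSet) := by
  have : Nonempty V := ⟨hU.choose⟩
  have hf0 : ∀ v, 0 ≤ f v := fun v => hc.le.trans (hf v)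
  refine ((integrable_cost f hU).div_const c).mono'
    (measurable_cost_div_opt f U).aestronglyMeasurable ?_
  filter_upwards [ae_expPi_nonneg (ι := (⊤ : SimpleGraph V).edgeSet)] with x hx
  have h1 := le_opt_pathDist hf0 hf (extendWeight_nonneg hx)
  have h2 : 0 ≤ cost f (pathDist (extendWeight x)) U := by
    rw [cost_eq]
    exact add_nonneg (Finset.sum_nonneg fun v _ => hf0 v)
      (connCost_nonneg (extendWeight_nonneg hx) hU)
  rw [Real.norm_of_nonneg (div_nonneg h2 (hc.le.trans h1))]
  gcongr

theorem one_le_integral_cost_div_opt {f : V → ℝ} {c : ℝ} (hc : 0 < c) (hf : ∀ v, c ≤ f v)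
    {U : Finset V} (hU : U.Nonempty) :
    1 ≤ ∫ x, cost f (pathDist (extendWeight x)) U / opt f (pathDist (extendWeight x))
      ∂expPi (⊤ : SimpleGraph V).edgeSet := by
  have : Nonempty V := ⟨hU.choose⟩
  calc (1 : ℝ) = ∫ _, (1 : ℝ) ∂expPi (⊤ : SimpleGraph V).edgeSet := by simp
    _ ≤ _ := by
      refine integral_mono_ae (integrable_const _) (integrable_cost_div_opt hc hf hU) ?_
      filter_upwards [ae_expPi_nonneg (ι := (⊤ : SimpleGraph V).edgeSet)] with x hx
      have h1 := le_opt_pathDist (fun v => hc.le.trans (hf v)) hf (extendWeight_nonneg hx)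
      rw [one_le_div (hc.trans_le h1)]
      exact opt_le_cost f _ hU

/-- Compare with a star and apply Cauchy–Schwarz. The bound is crude, but any power of `n` suffices
against a polynomially small exceptional probability. -/
theorem integral_connCost_sq_le {U : Finset V} (hU : U.Nonempty) :
    ∫ x, connCost (extendWeight x) U ^ 2 ∂expPi (⊤ : SimpleGraph V).edgeSet ≤
      (Fintype.card V : ℝ) ^ 2 * ∫ x, x ^ 2 ∂expMeasure 1 := by
  obtain ⟨u, hu⟩ := hU
  have hint : ∀ v, Integrable (fun x => extendWeight x s(u, v) ^ 2)
      (expPi (⊤ : SimpleGraph V).edgeSet) := by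
    intro v
    by_cases h : u = v
    · subst h
      simp [extendWeight_self]
    · simp only [extendWeight_of_ne _ h]
      exact (memLp_two_eval _).integrable_sq
  have hσ : 0 ≤ ∫ x : ℝ, x ^ 2 ∂expMeasure 1 := integral_nonneg fun x => sq_nonneg x
  have hle : ∀ v, ∫ x, extendWeight x s(u, v) ^ 2 ∂expPi (⊤ : SimpleGraph V).edgeSet ≤
      ∫ x, x ^ 2 ∂expMeasure 1 := by
    intro v
    by_cases h : u = v
    · subst h
      simpa [extendWeight_self] using hσ
    · simp only [extendWeight_of_ne _ h]
      exact (integral_eval_sq _).le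
  calc _ ≤ ∫ x, (Fintype.card V : ℝ) * ∑ v, extendWeight x s(u, v) ^ 2
        ∂expPi (⊤ : SimpleGraph V).edgeSet := by
        refine integral_mono_ae (memLp_connCost ⟨u, hu⟩).integrable_sq
          ((integrable_finsetSum _ fun v _ => hint v).const_mul _) ?_
        filter_upwards [ae_expPi_nonneg (ι := (⊤ : SimpleGraph V).edgeSet)] with x hx
        have h0 := connCost_nonneg (extendWeight_nonneg hx) ⟨u, hu⟩
        have h1 := connCost_le_sum (extendWeight_nonneg hx) hu
        exact (pow_le_pow_left₀ h0 h1 2).trans sq_sum_le_card_mul_sum_sq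
    _ = (Fintype.card V : ℝ) *
        ∑ v, ∫ x, extendWeight x s(u, v) ^ 2 ∂expPi (⊤ : SimpleGraph V).edgeSet := by
        rw [integral_const_mul, integral_finsetSum _ fun v _ => hint v]
    _ ≤ (Fintype.card V : ℝ) * ∑ _v : V, ∫ x, x ^ 2 ∂expMeasure 1 := by
        gcongr with v
        exact hle v
    _ = _ := by
        rw [Finset.sum_const, Finset.card_univ, nsmul_eq_mul]
        ring

/-- If `OPT` is at least `A` outside of the event `B`, then the expected ratio is at most
`E[ALG] / A` up to an error controlled by the probability of `B`. -/
theorem integral_cost_div_opt_le {f : V → ℝ} {c : ℝ} (hc : 0 < c) (hf : ∀ v, c ≤ f v)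
    {U : Finset V} (hU : U.Nonempty) {A a : ℝ} (hA : 0 < A) (ha : 0 < a)
    {B : Set ((⊤ : SimpleGraph V).edgeSet → ℝ)} (hB : MeasurableSet B)
    (hopt : ∀ x, (∀ e, 0 ≤ x e) → x ∉ B → A ≤ opt f (pathDist (extendWeight x))) :
    ∫ x, cost f (pathDist (extendWeight x)) U / opt f (pathDist (extendWeight x))
      ∂expPi (⊤ : SimpleGraph V).edgeSet ≤
      (∑ u ∈ U, f u + ∑ i ∈ Finset.Ico U.card (Fintype.card V), (1 : ℝ) / i) / A +
      ((∑ u ∈ U, f u + a⁻¹ / 2) * (expPi (⊤ : SimpleGraph V).edgeSet).real B +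
        a / 2 * ((Fintype.card V : ℝ) ^ 2 * ∫ x, x ^ 2 ∂expMeasure 1)) / c := by
  have : Nonempty V := ⟨hU.choose⟩
  have hf0 : ∀ v, 0 ≤ f v := fun v => hc.le.trans (hf v)
  set F := ∑ u ∈ U, f u
  have hF : 0 ≤ F := Finset.sum_nonneg fun v _ => hf0 v
  have hi1 : Integrable (fun x => (F + connCost (extendWeight x) U) / A)
      (expPi (⊤ : SimpleGraph V).edgeSet) :=
    ((integrable_const F).add (integrable_connCost hU)).div_const A
  have hi2 : Integrable (fun x => B.indicator (fun _ => F + a⁻¹ / 2) x)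
      (expPi (⊤ : SimpleGraph V).edgeSet) := (integrable_const _).indicator hB
  have hi3 : Integrable (fun x => a / 2 * connCost (extendWeight x) U ^ 2)
      (expPi (⊤ : SimpleGraph V).edgeSet) := (memLp_connCost hU).integrable_sq.const_mul _
  have hpt : ∀ᵐ x ∂expPi (⊤ : SimpleGraph V).edgeSet,
      cost f (pathDist (extendWeight x)) U / opt f (pathDist (extendWeight x)) ≤
      (F + connCost (extendWeight x) U) / A +
      (B.indicator (fun _ => F + a⁻¹ / 2) x + a / 2 * connCost (extendWeight x) U ^ 2) / c := by
    filter_upwards [ae_expPi_nonneg (ι := (⊤ : SimpleGraph V).edgeSet)] with x hx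
    have h0 := connCost_nonneg (extendWeight_nonneg hx) hU
    have h1 := le_opt_pathDist hf0 hf (extendWeight_nonneg hx)
    rw [cost_eq]
    by_cases hxB : x ∈ B
    · rw [Set.indicator_of_mem hxB]
      have h2 : (F + connCost (extendWeight x) U) / opt f (pathDist (extendWeight x)) ≤
          (F + connCost (extendWeight x) U) / c := by gcongr
      -- A weighted arithmetic-geometric mean inequality splits the cost into a constant, charged to
      -- the probability of `B`, and a square, charged to the second moment; `a` balances the two.
      have h3 : connCost (extendWeight x) U ≤
          a⁻¹ / 2 + a / 2 * connCost (extendWeight x) U ^ 2 := by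
        have h4 := mul_nonneg (inv_pos.2 ha).le (sq_nonneg (a * connCost (extendWeight x) U - 1))
        have h5 : a⁻¹ * (a * connCost (extendWeight x) U - 1) ^ 2 =
            a * connCost (extendWeight x) U ^ 2 - 2 * connCost (extendWeight x) U + a⁻¹ := by
          field_simp
          ring
        linarith
      have h4 : (F + connCost (extendWeight x) U) / c ≤
          (F + a⁻¹ / 2 + a / 2 * connCost (extendWeight x) U ^ 2) / c := by
        gcongr ?_ / c
        linarith
      have h5 : 0 ≤ (F + connCost (extendWeight x) U) / A := by positivity
      linarith
    · rw [Set.indicator_of_notMem hxB]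
      have h2 : (F + connCost (extendWeight x) U) / opt f (pathDist (extendWeight x)) ≤
          (F + connCost (extendWeight x) U) / A := by
        gcongr
        exact hopt x hx hxB
      have h3 : 0 ≤ (0 + a / 2 * connCost (extendWeight x) U ^ 2) / c := by positivity
      linarith
  refine (integral_mono_ae (integrable_cost_div_opt hc hf hU)
    (hi1.add ((hi2.add hi3).div_const c)) hpt).trans ?_
  have e1 : ∫ x, (F + connCost (extendWeight x) U) / A ∂expPi (⊤ : SimpleGraph V).edgeSet ≤
      (F + ∑ i ∈ Finset.Ico U.card (Fintype.card V), (1 : ℝ) / i) / A := by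
    rw [integral_div, integral_add (integrable_const F) (integrable_connCost hU)]
    gcongr ?_ / A
    refine add_le_add (by simp) (integral_connCost_le hU)
  have e2 : ∫ x, B.indicator (fun _ => F + a⁻¹ / 2) x ∂expPi (⊤ : SimpleGraph V).edgeSet =
      (F + a⁻¹ / 2) * (expPi (⊤ : SimpleGraph V).edgeSet).real B := by
    rw [integral_indicator_const _ hB, smul_eq_mul, mul_comm]
  have e3 : ∫ x, a / 2 * connCost (extendWeight x) U ^ 2 ∂expPi (⊤ : SimpleGraph V).edgeSet ≤
      a / 2 * ((Fintype.card V : ℝ) ^ 2 * ∫ x, x ^ 2 ∂expMeasure 1) := by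
    rw [integral_const_mul]
    gcongr
    exact integral_connCost_sq_le hU
  have e4 : ∫ x, (B.indicator (fun _ => F + a⁻¹ / 2) x + a / 2 * connCost (extendWeight x) U ^ 2) / c
      ∂expPi (⊤ : SimpleGraph V).edgeSet ≤
      ((F + a⁻¹ / 2) * (expPi (⊤ : SimpleGraph V).edgeSet).real B +
        a / 2 * ((Fintype.card V : ℝ) ^ 2 * ∫ x, x ^ 2 ∂expMeasure 1)) / c := by
    rw [integral_div, integral_add hi2 hi3, e2]
    gcongr
  calc _ = ∫ x, (F + connCost (extendWeight x) U) / A ∂expPi (⊤ : SimpleGraph V).edgeSet +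
        ∫ x, (B.indicator (fun _ => F + a⁻¹ / 2) x +
          a / 2 * connCost (extendWeight x) U ^ 2) / c ∂expPi (⊤ : SimpleGraph V).edgeSet :=
        integral_add hi1 ((hi2.add hi3).div_const c)
    _ ≤ _ := add_le_add e1 e4

end Ratio

/-! ### The bound for fixed `n`. -/

section Heuristic

variable {n : ℕ} {f : Fin n → ℝ}

/-- A bound for the expected approximation ratio, for fixed `n`. -/
theorem integral_ratio_le (hn : 0 < n) (hf : Monotone f) (hpos : ∀ i, 0 < f i) {U : Finset (Fin n)}
    (hU : IsCheapest f (kappa f) U) {c : ℝ} (hc : 0 < c) (hcf : ∀ i, c ≤ f i) {Q : ℕ}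
    (hfc : ∀ i, f i ≤ (n : ℝ) ^ Q * c) (hnc : 1 ≤ (n : ℝ) ^ (Q + 1) * c) {M : ℕ}
    (hM : 2 * Q + 9 ≤ M) {δ : ℝ} (hδ0 : 0 < δ) (hδ : δ ≤ 1 / 2)
    (hδM : Real.exp 1 * ((M : ℝ) + 1) ^ M * δ ≤ 1)
    (hA : 0 < (1 - ((2 * Q + 9 : ℕ) : ℝ) / M) * (∑ u ∈ U, f u + Real.log ((n : ℝ) / kappa f)) -
      (Real.log δ⁻¹ + 1)) :
    ∫ x, cost f (pathDist (extendWeight x)) U / opt f (pathDist (extendWeight x))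
      ∂expPi (⊤ : SimpleGraph (Fin n)).edgeSet ≤
      (∑ u ∈ U, f u + (1 + Real.log ((n : ℝ) / kappa f))) /
        ((1 - ((2 * Q + 9 : ℕ) : ℝ) / M) * (∑ u ∈ U, f u + Real.log ((n : ℝ) / kappa f)) -
          (Real.log δ⁻¹ + 1)) + (2 + ∫ x, x ^ 2 ∂expMeasure 1) / n := by
  have : Nonempty (Fin n) := ⟨⟨0, hn⟩⟩
  have hn' : (0 : ℝ) < n := by exact_mod_cast hn
  have hn1 : (1 : ℝ) ≤ n := by exact_mod_cast hn
  have hM' : (0 : ℝ) < M := by exact_mod_cast (by lia : 0 < M)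
  have hUne : U.Nonempty := Finset.card_pos.1 (hU.1 ▸ kappa_pos hn)
  set ε : ℝ := ((2 * Q + 9 : ℕ) : ℝ) / M with hε
  have hε0 : 0 ≤ ε := by positivity
  have hε1 : ε ≤ 1 := by
    rw [hε, div_le_one hM']
    exact_mod_cast hM
  set F := ∑ u ∈ U, f u
  set L := Real.log ((n : ℝ) / kappa f)
  set σ := ∫ x, x ^ 2 ∂expMeasure 1
  have hσ : 0 ≤ σ := integral_nonneg fun x => sq_nonneg x
  set A := (1 - ε) * (F + L) - (Real.log δ⁻¹ + 1)
  set B : Set ((⊤ : SimpleGraph (Fin n)).edgeSet → ℝ) := {x | ∃ W : Finset (Fin n), W.Nonempty ∧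
    (W.card : ℝ) ≤ δ * Fintype.card (Fin n) ∧ connCost (extendWeight x) W <
      (1 - ((2 * Q + 6 + 3 : ℕ) : ℝ) / M) * Real.log (Fintype.card (Fin n) / W.card)} with hBdef
  have hBm : MeasurableSet B := by
    have : B = ⋃ W : {W : Finset (Fin n) // W.Nonempty ∧ (W.card : ℝ) ≤ δ * Fintype.card (Fin n)},
        {x | connCost (extendWeight x) W < (1 - ((2 * Q + 6 + 3 : ℕ) : ℝ) / M) *
          Real.log (Fintype.card (Fin n) / (W : Finset (Fin n)).card)} := by
      ext x
      simp [hBdef, and_assoc]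
    rw [this]
    exact MeasurableSet.iUnion fun W =>
      measurableSet_lt (measurable_connCost_extendWeight _) measurable_const
  have hp := measureReal_exists_connCost_lt_le (V := Fin n) (2 * Q + 6) M hM hδ hδM
  change (expPi (⊤ : SimpleGraph (Fin n)).edgeSet).real B ≤ _ at hp
  rw [Fintype.card_fin] at hp
  set p := (expPi (⊤ : SimpleGraph (Fin n)).edgeSet).real B
  have hp0 : 0 ≤ p := measureReal_nonneg
  have hopt : ∀ x, (∀ e, 0 ≤ x e) → x ∉ B → A ≤ opt f (pathDist (extendWeight x)) := by
    intro x hx hxB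
    refine le_opt fun W hW => ?_
    rw [cost_eq]
    refine le_sum_add_of_log_le hf hpos hU hW hε0 hε1 ?_
    have hk : (0 : ℝ) < W.card := by exact_mod_cast hW.card_pos
    have hlogδ : 0 ≤ Real.log δ⁻¹ := Real.log_nonneg ((one_le_inv₀ hδ0).2 (by linarith))
    by_cases hWδ : (W.card : ℝ) ≤ δ * n
    · have h1 : ¬ connCost (extendWeight x) W < (1 - ε) * Real.log ((n : ℝ) / W.card) := fun h =>
        hxB ⟨W, hW, by simpa using hWδ, by rw [Fintype.card_fin]; exact h⟩
      linarith
    -- For large `W` the logarithm is at most `log δ⁻¹`, so the subtracted constant already makes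
    -- the required lower bound nonpositive.
    · push Not at hWδ
      have h1 : Real.log ((n : ℝ) / W.card) ≤ Real.log δ⁻¹ := by
        refine Real.log_le_log (by positivity) ?_
        rw [div_le_iff₀ hk, inv_mul_eq_div, le_div_iff₀ hδ0, mul_comm]
        exact hWδ.le
      have h2 : (1 - ε) * Real.log ((n : ℝ) / W.card) ≤ (1 - ε) * Real.log δ⁻¹ :=
        mul_le_mul_of_nonneg_left h1 (by linarith)
      have h3 := mul_nonneg hε0 hlogδ
      linarith [connCost_nonneg (extendWeight_nonneg hx) hW]
  -- With `a = n ^ (-(Q+4))`, `p ≤ n ^ (-(2Q+6))` and `c ≥ n ^ (-(Q+1))`, both `p / (a * c)` and `a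
  -- * n ^ 2 / c` are at most `1/n`; this dictates the exponents.
  have ha : (0 : ℝ) < ((n : ℝ) ^ (Q + 4))⁻¹ := by positivity
  refine (integral_cost_div_opt_le hc hcf hUne hA ha hBm hopt).trans ?_
  rw [Fintype.card_fin, inv_inv, hU.1]
  have hF : F ≤ (n : ℝ) ^ (Q + 1) * c := by
    calc F ≤ U.card • ((n : ℝ) ^ Q * c) := Finset.sum_le_card_nsmul _ _ _ fun i _ => hfc i
      _ ≤ (n : ℝ) * ((n : ℝ) ^ Q * c) := by
          rw [nsmul_eq_mul]
          gcongr
          exact (Finset.card_le_univ U).trans_eq (Fintype.card_fin n)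
      _ = _ := by ring
  have hκn := kappa_le (f := f)
  have hsum := sum_Ico_le_one_add_log (kappa_pos (f := f) hn) hκn
  refine add_le_add (by gcongr) ?_
  rw [div_le_iff₀ hc]
  have hN : (1 : ℝ) ≤ (n : ℝ) ^ (Q + 4) := one_le_pow₀ hn1
  have hpn : p * (n : ℝ) ^ (2 * Q + 6) ≤ 1 := by
    calc p * (n : ℝ) ^ (2 * Q + 6) ≤ (1 / (n : ℝ)) ^ (2 * Q + 6) * (n : ℝ) ^ (2 * Q + 6) := by gcongr
      _ = 1 := by rw [← mul_pow, one_div_mul_cancel hn'.ne', one_pow]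
  have hc1 : 1 / (n : ℝ) ^ (Q + 1) ≤ c := by
    rw [div_le_iff₀ (by positivity), mul_comm]
    exact hnc
  have t1 : F * p ≤ c / n := by
    rw [le_div_iff₀ hn']
    calc F * p * n ≤ (n : ℝ) ^ (Q + 1) * c * p * n := by gcongr
      _ = c * (p * (n : ℝ) ^ (Q + 2)) := by ring
      _ ≤ c * (p * (n : ℝ) ^ (2 * Q + 6)) :=
          mul_le_mul_of_nonneg_left
            (mul_le_mul_of_nonneg_left (pow_le_pow_right₀ hn1 (by lia)) hp0) hc.le
      _ ≤ c * 1 := by gcongr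
      _ = c := mul_one c
  have t2 : (n : ℝ) ^ (Q + 4) / 2 * p ≤ c / n := by
    rw [le_div_iff₀ hn']
    refine le_trans ?_ hc1
    rw [le_div_iff₀ (by positivity)]
    calc _ = p * (n : ℝ) ^ (2 * Q + 6) / 2 := by ring
      _ ≤ 1 := by linarith
  have t3 : ((n : ℝ) ^ (Q + 4))⁻¹ / 2 * ((n : ℝ) ^ 2 * σ) ≤ σ * (c / n) := by
    have h1 : 1 / (n : ℝ) ^ (Q + 2) ≤ c / n := by
      rw [le_div_iff₀ hn']
      refine le_trans (le_of_eq ?_) hc1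
      rw [pow_succ (n : ℝ) (Q + 1)]
      field_simp
    calc _ = σ * (1 / (n : ℝ) ^ (Q + 2)) / 2 := by
          rw [show Q + 4 = Q + 2 + 2 by ring, pow_add (n : ℝ) (Q + 2) 2]
          field_simp
      _ ≤ σ * (1 / (n : ℝ) ^ (Q + 2)) := half_le_self (by positivity)
      _ ≤ _ := by gcongr
  calc _ = F * p + (n : ℝ) ^ (Q + 4) / 2 * p + ((n : ℝ) ^ (Q + 4))⁻¹ / 2 * ((n : ℝ) ^ 2 * σ) := by
        ring
    _ ≤ c / n + c / n + σ * (c / n) := by gcongr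
    _ = _ := by ring

end Heuristic

/-! ### Passage to the limit and transfer from the product space. -/

theorem tendsto_log_div_kappa {f : ∀ n : ℕ, Fin n → ℝ}
    (hκ : (fun n : ℕ => (kappa (f n) : ℝ)) =o[atTop] (fun n : ℕ => (n : ℝ))) :
    Tendsto (fun n : ℕ => Real.log ((n : ℝ) / kappa (f n))) atTop atTop := by
  rw [tendsto_atTop]
  intro X
  filter_upwards [hκ.bound (Real.exp_pos (-X)), eventually_gt_atTop 0] with n h hn
  have hκ0 : (0 : ℝ) < kappa (f n) := by exact_mod_cast kappa_pos hn
  rw [Real.norm_of_nonneg hκ0.le, Real.norm_of_nonneg (Nat.cast_nonneg n), Real.exp_neg,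
    inv_mul_eq_div, le_div_iff₀ (Real.exp_pos _)] at h
  rw [Real.le_log_iff_exp_le (by positivity), le_div_iff₀ hκ0, mul_comm]
  exact h

theorem eventually_kappa_lt {f : ∀ n : ℕ, Fin n → ℝ}
    (hκ : (fun n : ℕ => (kappa (f n) : ℝ)) =o[atTop] (fun n : ℕ => (n : ℝ))) :
    ∀ᶠ n in atTop, kappa (f n) < n := by
  filter_upwards [hκ.bound (one_half_pos (α := ℝ)), eventually_gt_atTop 0] with n h hn
  rw [Real.norm_of_nonneg (Nat.cast_nonneg _), Real.norm_of_nonneg (Nat.cast_nonneg n)] at h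
  have hn' : (0 : ℝ) < n := by exact_mod_cast hn
  have : (kappa (f n) : ℝ) < n := by linarith
  exact_mod_cast this

/-- Convergence of the expected ratio on the product space. -/
theorem tendsto_integral_expPi (f : ∀ n : ℕ, Fin n → ℝ) (hpos : ∀ n i, 0 < f n i)
    (hmono : ∀ n, Monotone (f n)) (q : ℝ)
    (hq : ∀ᶠ n : ℕ in atTop, ∀ i j : Fin n, f n i / f n j ≤ (n : ℝ) ^ q)
    (hκ : (fun n : ℕ => (kappa (f n) : ℝ)) =o[atTop] (fun n : ℕ => (n : ℝ)))
    (U : ∀ n : ℕ, Finset (Fin n)) (hU : ∀ n, IsCheapest (f n) (kappa (f n)) (U n)) :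
    Tendsto (fun n => ∫ x, cost (f n) (pathDist (extendWeight x)) (U n) /
      opt (f n) (pathDist (extendWeight x)) ∂expPi (⊤ : SimpleGraph (Fin n)).edgeSet)
      atTop (𝓝 1) := by
  obtain ⟨Q, hQ⟩ := exists_nat_ge q
  set σ := ∫ x, x ^ 2 ∂expMeasure 1
  refine tendsto_order.2 ⟨fun b hb => ?_, fun b hb => ?_⟩
  · filter_upwards [eventually_gt_atTop 0] with n hn
    have hne : (U n).Nonempty := Finset.card_pos.1 ((hU n).1 ▸ kappa_pos hn)
    exact hb.trans_le (one_le_integral_cost_div_opt (hpos n ⟨0, hn⟩)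
      (fun v => hmono n (Nat.zero_le _)) hne)
  obtain ⟨η, hη, rfl⟩ : ∃ η : ℝ, 0 < η ∧ b = 1 + 2 * η := ⟨(b - 1) / 2, by linarith, by ring⟩
  -- The first summand gives `ε * (1 + η) ≤ η / 2`, the second ensures `2 * Q + 9 ≤ M`.
  obtain ⟨M, hM⟩ := exists_nat_ge
    (((2 * Q + 9 : ℕ) : ℝ) * (2 * (1 + η) / η) + ((2 * Q + 9 : ℕ) : ℝ))
  have hT : (0 : ℝ) < ((2 * Q + 9 : ℕ) : ℝ) := by exact_mod_cast (by lia : 0 < 2 * Q + 9)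
  have hTη : 0 < ((2 * Q + 9 : ℕ) : ℝ) * (2 * (1 + η) / η) := by positivity
  have hMT : 2 * Q + 9 ≤ M := by
    have : ((2 * Q + 9 : ℕ) : ℝ) ≤ M := by linarith
    exact_mod_cast this
  have hM' : (0 : ℝ) < M := by linarith
  set ε : ℝ := ((2 * Q + 9 : ℕ) : ℝ) / M with hε
  have hεη : ε * (1 + η) ≤ η / 2 := by
    rw [hε, div_mul_eq_mul_div, div_le_iff₀ hM']
    calc _ = η / 2 * (((2 * Q + 9 : ℕ) : ℝ) * (2 * (1 + η) / η)) := by field_simp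
      _ ≤ η / 2 * M := by gcongr; linarith
  have hD : (0 : ℝ) < Real.exp 1 * ((M : ℝ) + 1) ^ M := by positivity
  set δ : ℝ := min (1 / 2) (1 / (Real.exp 1 * ((M : ℝ) + 1) ^ M)) with hδ
  have hδ0 : 0 < δ := lt_min (by norm_num) (by positivity)
  have hδM : Real.exp 1 * ((M : ℝ) + 1) ^ M * δ ≤ 1 := by
    calc _ ≤ Real.exp 1 * ((M : ℝ) + 1) ^ M * (1 / (Real.exp 1 * ((M : ℝ) + 1) ^ M)) :=
          mul_le_mul_of_nonneg_left (min_le_right _ _) hD.le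
      _ = 1 := mul_one_div_cancel hD.ne'
  set C := Real.log δ⁻¹ + 1
  have hlim : Tendsto (fun n : ℕ => (2 + σ) / (n : ℝ)) atTop (𝓝 0) :=
    tendsto_const_div_atTop_nhds_zero_nat _
  filter_upwards [hq, eventually_kappa_lt hκ, eventually_gt_atTop 0,
    (tendsto_log_div_kappa hκ).eventually_ge_atTop ((1 + (1 + η) * C) / (η / 2)),
    (tendsto_order.1 hlim).2 η hη] with n hqn hκn hn hL hlt
  have hn1 : (1 : ℝ) ≤ n := by exact_mod_cast hn
  set c := f n ⟨0, hn⟩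
  have hc : 0 < c := hpos n _
  have hcf : ∀ i, c ≤ f n i := fun v => hmono n (Nat.zero_le _)
  have hfc : ∀ i, f n i ≤ (n : ℝ) ^ Q * c := fun i => by
    have h := hqn i ⟨0, hn⟩
    rw [div_le_iff₀ (hpos n _)] at h
    refine h.trans ?_
    rw [← Real.rpow_natCast]
    gcongr
  have hκ0 : (0 : ℝ) < kappa (f n) := by exact_mod_cast kappa_pos hn
  have hκn' : (kappa (f n) : ℝ) ≤ n := by exact_mod_cast hκn.le
  -- Because `κ < n`, there is a first facility beyond the threshold; it costs at least `1/κ`, hence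
  -- at least `1/n`, and the ratio bound carries this down to the cheapest one.
  have hnc : 1 ≤ (n : ℝ) ^ (Q + 1) * c := by
    have h1 := (le_of_kappa_le (f := f n) ⟨kappa (f n), hκn⟩ le_rfl).trans (hfc _)
    rw [div_le_iff₀ hκ0] at h1
    calc (1 : ℝ) ≤ (n : ℝ) ^ Q * c * kappa (f n) := h1
      _ ≤ (n : ℝ) ^ Q * c * n := by gcongr
      _ = _ := by ring
  set F := ∑ u ∈ U n, f n u
  have hF : 0 ≤ F := Finset.sum_nonneg fun u _ => (hpos n u).le
  set L := Real.log ((n : ℝ) / kappa (f n))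
  -- Since `(1 + η)(1 - ε) ≥ 1 + η/2`, a slack of `η/2 * (F + L)` is available to absorb every
  -- additive constant.
  have hz : 1 + (1 + η) * C ≤ η / 2 * (F + L) := by
    rw [div_le_iff₀ (by positivity)] at hL
    have := mul_nonneg (half_pos hη).le hF
    linarith
  have hL0 : 0 ≤ L := Real.log_nonneg (by rwa [one_le_div hκ0])
  have hmain : F + (1 + L) ≤ (1 + η) * ((1 - ε) * (F + L) - C) := by
    have h1 := mul_le_mul_of_nonneg_right hεη (add_nonneg hF hL0)
    linarith
  have hA : 0 < (1 - ε) * (F + L) - C := by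
    by_contra h
    push Not at h
    have := mul_nonpos_of_nonneg_of_nonpos (by positivity : 0 ≤ 1 + η) h
    linarith
  have hbound := integral_ratio_le hn (hmono n) (hpos n) (hU n) hc hcf hfc hnc hMT hδ0
    (min_le_left _ _) hδM hA
  have hdiv : (F + (1 + L)) / ((1 - ε) * (F + L) - C) ≤ 1 + η := by
    rwa [div_le_iff₀ hA]
  calc _ ≤ _ := hbound
    _ ≤ (1 + η) + (2 + σ) / n := by gcongr
    _ < 1 + 2 * η := by linarith

theorem hasLaw_expPi {V Ω : Type*} [Fintype V] [DecidableEq V] [MeasurableSpace Ω] {P : Measure Ω}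
    {w : Sym2 V → Ω → ℝ}
    (hw : ∀ e ∈ (⊤ : SimpleGraph V).edgeSet, HasLaw (w e) (expMeasure 1) P)
    (hindep : iIndepFun (fun e : (⊤ : SimpleGraph V).edgeSet => w (e : Sym2 V)) P) :
    HasLaw (fun ω (e : (⊤ : SimpleGraph V).edgeSet) => w e ω)
      (expPi (⊤ : SimpleGraph V).edgeSet) P :=
  hindep.hasLaw_pi fun e => hw e e.2

end FacilityLocation

theorem theorem1
    -- for every `n`, positive opening costs, numbered in nondecreasing order
    (f : ∀ n : ℕ, Fin n → ℝ)
    (hpos : ∀ n i, 0 < f n i)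
    (hmono : ∀ n, Monotone (f n))
    -- the ratios of the opening costs are polynomially bounded
    (q : ℝ)
    (hq : ∀ᶠ n : ℕ in atTop, ∀ i j : Fin n, f n i / f n j ≤ (n : ℝ) ^ q)
    -- `κ = o(n)`
    (hκ : (fun n : ℕ => (FacilityLocation.kappa (f n) : ℝ)) =o[atTop] (fun n : ℕ => (n : ℝ)))
    -- the set of facilities that the heuristic opens, chosen independently of the metric
    (U : ∀ n : ℕ, Finset (Fin n))
    (hU : ∀ n, FacilityLocation.IsCheapest (f n) (FacilityLocation.kappa (f n)) (U n))
    -- independent standard exponential weights on the edges of the complete graph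
    {Ω : ℕ → Type*} [∀ n, MeasurableSpace (Ω n)]
    (P : ∀ n, Measure (Ω n)) [∀ n, IsProbabilityMeasure (P n)]
    (w : ∀ n : ℕ, Sym2 (Fin n) → Ω n → ℝ)
    (hw : ∀ n, ∀ e ∈ (⊤ : SimpleGraph (Fin n)).edgeSet, HasLaw (w n e) (expMeasure 1) (P n))
    (hindep : ∀ n,
      iIndepFun (fun e : (⊤ : SimpleGraph (Fin n)).edgeSet => w n (e : Sym2 (Fin n))) (P n)) :
    (∀ n, Integrable (fun ω =>
        FacilityLocation.cost (f n) (FacilityLocation.pathDist fun e => w n e ω) (U n) /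
          FacilityLocation.opt (f n) (FacilityLocation.pathDist fun e => w n e ω)) (P n)) ∧
      Tendsto (fun n => ∫ ω,
        FacilityLocation.cost (f n) (FacilityLocation.pathDist fun e => w n e ω) (U n) /
          FacilityLocation.opt (f n) (FacilityLocation.pathDist fun e => w n e ω) ∂(P n))
        atTop (𝓝 1) := by

  have hlaw := fun n => FacilityLocation.hasLaw_expPi (hw n) (hindep n)
  have hmeas := fun n => FacilityLocation.measurable_cost_div_opt (f n) (U n)
  have heq : ∀ n ω, FacilityLocation.pathDist (fun e => w n e ω) =
      FacilityLocation.pathDist (FacilityLocation.extendWeight fun e => w n e ω) := fun n ω =>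
    (FacilityLocation.pathDist_extendWeight _).symm
  simp only [heq]
  constructor
  · intro n
    -- Without vertices the cost is an empty sum, so the quotient is `0`.
    rcases Nat.eq_zero_or_pos n with rfl | hn
    · simp [FacilityLocation.cost, Finset.eq_empty_of_isEmpty (U 0)]
    have hne : (U n).Nonempty := Finset.card_pos.1 ((hU n).1 ▸ FacilityLocation.kappa_pos hn)
    have h := FacilityLocation.integrable_cost_div_opt (f := f n) (hpos n ⟨0, hn⟩)
      (fun v => hmono n (Nat.zero_le _)) hne
    rw [← (hlaw n).map_eq] at h
    exact h.comp_aemeasurable (hlaw n).aemeasurable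
  · refine (FacilityLocation.tendsto_integral_expPi f hpos hmono q hq hκ U hU).congr fun n => ?_
    exact ((hlaw n).integral_comp (hmeas n).aestronglyMeasurable).symm
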